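/- Units $\hbar=c=K=1$, metric $\mathrm{diag}(1,-1,-1,-1)$, $\epsilon^{0123}=1$. Let $\widehat\psi$ be the free neutral massless scalar field on Minkowski space-time, $\widehat\psi(x)=(2\pi)^{-3/2}\int\frac{d^3p}{2\varepsilon}\,[e^{-ip\cdot x}\widehat a_p+e^{ip\cdot x}\widehat a^\dagger_p]$ with $\varepsilon=|\mathbf p|$ and $[\widehat a_p,\widehat a^\dagger_{p'}]=2\varepsilon\,\delta^3(\mathbf p-\mathbf p')$, and consider the global equilibrium $\widehat\rho=\frac1Z\exp[-b\cdot\widehat P+\frac12\varpi_{\mu\nu}\widehat J^{\mu\nu}]$. *Definition of the mean value.* For imaginary $\varpi$ write $\exp[-b\cdot\widehat P+\frac12\varpi:\widehat J]=e^{-\tilde b\cdot\widehat P}\,\widehat\Lambda$ with $\Lambda$ a real Lorentz transformation. The relation $\langle \widehat a^\dagger_p\widehat a_{p'}\rangle=e^{-\tilde b\cdot\Lambda p}\langle \widehat a^\dagger_{\Lambda p}\widehat a_{p'}\rangle+2\varepsilon'\delta^3(\Lambda\mathbf p-\mathbf p')e^{-\tilde b\cdot p'}$, solved by iteration starting from $0$,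 defines $\langle \widehat a^\dagger_p\widehat a_{p'}\rangle$ and hence $\langle:\widehat\psi^2(x):\rangle_I=\frac{1}{(2\pi)^{3}}\int\frac{d^3p}{\varepsilon}\int\frac{d^3p'}{2\varepsilon'}e^{i(p-p')\cdot x}\langle \widehat a^\dagger_p\widehat a_{p'}\rangle$. Let $f$ be a function on $D\subset\mathbb C$. Suppose that $D$ is a finite union of subsets $D_i$ accumulating at $z_0$, that $f$ has an asymptotic power series $\sum_n a^{(i)}_n(z-z_0)^n$ (finitely many negative powers) in each $D_i$, and that the series $\sum_{n\ge0}\bar a_n(z-z_0)^n$ has positive radius of convergence, where $\bar a_n=a_n^{(i)}$ if this is the same for all $i$, and $\bar a_n=0$ otherwise. Its sum is the analytic distillate of $f$ in $z_0$. For real $b,\varpi$, the mean value $\langle:\widehat\psi^2(x):\rangle$ is obtained as follows: replace $\varpi$ by $-i\xi\varpi$ with $\xi\in\mathbb R\setminus\{0\}$, keeping the four-temperature $\beta^\mu(x)=b^\mu+\varpi^{\mu}{}_{\nu}x^\nu$ at the point $x$ fixed at its physical value; take the analytic distillate in $\xi=0$ of $\langle:\widehat\psi^2(x):\rangle_I$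 as a function of $\xi$; continue it analytically along the segment from $\xi=0$ to $\xi=i$; evaluate it at $\xi=i$. *Statement.* Let $T_0>0$, $a,\omega\in\mathbb R$, $b=(1/T_0,\mathbf 0)$, and let the non-zero components of $\varpi$ be $\varpi_{03}=-\varpi_{30}=a/T_0$, $\varpi_{12}=-\varpi_{21}=\omega/T_0$ (acceleration and rotation along $z$). Let $x=(t,x,y,z)$, $r^2=x^2+y^2$, be a point at which $$\beta^\mu=\frac1{T_0}(1+az,\,-\omega y,\,\omega x,\,at)$$ is time-like and future-directed, i.e. $1+az>0$ and $(1+az)^2-a^2t^2-r^2\omega^2>0$. Put $u=\beta/\sqrt{\beta^2}$, $\alpha^\mu=\varpi^{\mu\nu}u_\nu$, $w^\mu=-\frac12\epsilon^{\mu\nu\rho\sigma}\varpi_{\nu\rho}u_\sigma$. Then $$\beta^2=\frac{(1+az)^2-a^2t^2-r^2\omega^2}{T_0^2},\qquad \alpha^2=-\frac{a^2((1+az)^2-a^2t^2)+r^2\omega^4}{\beta^2T_0^4},\qquad \alpha\cdot w=-\frac{a\omega}{T_0^2}.$$ For every real $\xi$, the series and the momentum integral that define $\langle:\widehat\psi^2(x):\rangle_I$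 (at vorticity $-i\xi\varpi$ and four-temperature $\beta(x)$) converge. The mean value $\langle:\widehat\psi^2(x):\rangle$ exists, is unique, and equals $$\langle:\widehat\psi^2(x):\rangle=\frac{T_0^2}{12\left((1+az)^2-a^2t^2-r^2\omega^2\right)}-\frac{a^2\left((1+az)^2-a^2t^2\right)+r^2\omega^4}{48\pi^2\left((1+az)^2-a^2t^2-r^2\omega^2\right)^2}.$$ In invariant form, $$\langle:\widehat\psi^2(x):\rangle=\frac{1}{12\,\beta(x)^2}+\frac{\alpha(x)^2}{48\pi^2\,\beta(x)^2},$$ with no dependence on $\alpha\cdot w$. -/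

import Mathlib

open Complex MeasureTheory Filter Topology Asymptotics

noncomputable section

namespace ThermalField

/-! ### Minkowski space-time, signature `(+,-,-,-)`, coordinates `(t, x, y, z)` -/

/-- The Minkowski metric `diag(1,-1,-1,-1)`, which is its own inverse: it raises and lowers
indices. -/
def metric (R : Type*) [CommRing R] : Matrix (Fin 4) (Fin 4) R :=
  Matrix.diagonal ![1, -1, -1, -1]

/-- The (bilinear) Minkowski product `u · v` of contravariant four-vectors. -/
def mdot {R : Type*} [CommRing R] (u v : Fin 4 → R) : R :=
  u 0 * v 0 - u 1 * v 1 - u 2 * v 2 - u 3 * v 3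

/-- The Levi-Civita symbol with `ε^{0123} = 1`. -/
def leviCivita (μ ν ρ σ : Fin 4) : ℝ :=
  Matrix.det (Matrix.of fun i j : Fin 4 => if ![μ, ν, ρ, σ] i = j then (1 : ℝ) else 0)

/-! ### Thermodynamic fields of the equilibrium `exp[- b·P + ϖ:J/2] / Z`

`b` is given by its contravariant components `b^μ`, the thermal vorticity by its covariant
components `ϖ_{μν}`. -/

/-- The four-temperature `β^μ(x) = b^μ + ϖ^μ_ν x^ν`. -/
def fourTemp (b : Fin 4 → ℝ) (ϖ : Matrix (Fin 4) (Fin 4) ℝ) (x : Fin 4 → ℝ) : Fin 4 → ℝ :=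
  b + (metric ℝ * ϖ).mulVec x

/-- The four-velocity `u = β / √β²`. -/
def fourVel (β : Fin 4 → ℝ) : Fin 4 → ℝ := (Real.sqrt (mdot β β))⁻¹ • β

/-- `α^μ = ϖ^{μν} u_ν`, the acceleration divided by the local temperature. -/
def alphaVec (β : Fin 4 → ℝ) (ϖ : Matrix (Fin 4) (Fin 4) ℝ) : Fin 4 → ℝ :=
  (metric ℝ * ϖ).mulVec (fourVel β)

/-- `w^μ = - (1/2) ε^{μνρσ} ϖ_{νρ} u_σ`, the kinematic vorticity divided by the local
temperature. -/
def wVec (β : Fin 4 → ℝ) (ϖ : Matrix (Fin 4) (Fin 4) ℝ) : Fin 4 → ℝ := fun μ =>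
  -(1 / 2) * ∑ ν, ∑ ρ, ∑ σ,
    leviCivita μ ν ρ σ * ϖ ν ρ * (metric ℝ).mulVec (fourVel β) σ

/-! ### The density operator and the thermal mean values of `a†_p a_{p'}`

The Lorentz generators on four-vectors are
`(J_{μν})^α_β = i (δ^α_μ g_{νβ} - δ^α_ν g_{μβ})`, so that `ϖ:J/2` is the matrix `i ϖ^α_β`, and the
translation by `c` is `exp(i c·P)`. Hence the operator `- b·P + ϖ:J/2` corresponds to the affine
vector field `x ↦ (ϖ:J/2) x + i b` on complexified space-time. -/

/-- The element `- b·P + ϖ:J/2` of the complexified Poincaré Lie algebra, as an affine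
(`5 × 5`) matrix. -/
def densityGenerator (b : Fin 4 → ℂ) (ϖ : Matrix (Fin 4) (Fin 4) ℂ) :
    Matrix (Fin 4 ⊕ Unit) (Fin 4 ⊕ Unit) ℂ :=
  Matrix.fromBlocks (I • (metric ℂ * ϖ)) (Matrix.of fun μ _ => I * b μ) 0 0

/-- The element `exp[- b·P + ϖ:J/2]` of the complexified Poincaré group. -/
def densityElement (b : Fin 4 → ℂ) (ϖ : Matrix (Fin 4) (Fin 4) ℂ) :
    Matrix (Fin 4 ⊕ Unit) (Fin 4 ⊕ Unit) ℂ :=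
  NormedSpace.exp (densityGenerator b ϖ)

/-- The Lorentz part `Λ` of `exp[- b·P + ϖ:J/2] = T(c) Λ`. -/
def lorentzPart (b : Fin 4 → ℂ) (ϖ : Matrix (Fin 4) (Fin 4) ℂ) : Matrix (Fin 4) (Fin 4) ℂ :=
  (densityElement b ϖ).toBlocks₁₁

/-- The (complex) translation part `c` of `exp[- b·P + ϖ:J/2] = T(c) Λ`. -/
def translationPart (b : Fin 4 → ℂ) (ϖ : Matrix (Fin 4) (Fin 4) ℂ) : Fin 4 → ℂ :=
  fun μ => (densityElement b ϖ).toBlocks₁₂ μ ()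

/-- Three-momenta. The energy of a massless particle of momentum `p` is `ε = ‖p‖`. -/
abbrev Momentum : Type := EuclideanSpace ℝ (Fin 3)

/-- The on-shell four-momentum `(ε, 𝐩)` of a massless particle. -/
def onShell (p : Momentum) : Fin 4 → ℝ := Matrix.vecCons ‖p‖ (fun i => p i)

/-- A real four-vector as a complex one. -/
def toC (v : Fin 4 → ℝ) : Fin 4 → ℂ := fun μ => (v μ : ℂ)

/-- The space part of `Λ p`, for an actual Lorentz transformation `Λ` (a matrix with real
entries). -/
def lorentzAct (L : Matrix (Fin 4) (Fin 4) ℂ) (p : Momentum) : Momentum :=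
  WithLp.toLp 2 fun i : Fin 3 => (L.mulVec (toC (onShell p)) i.succ).re

/-- The action of the density operator on one-particle states. From
`T(c) a†_p T(c)⁻¹ = exp(i c·p) a†_p` and `Λ a†_p Λ⁻¹ = a†_{Λp}`, the (unnormalized) density operator
`ρ = T(c) Λ` satisfies `ρ a†_p ρ⁻¹ = exp(i c·Λp) a†_{Λp}`; this is that transformation with the
creation operators replaced by a function `g` of the momentum. -/
def oneParticle (b : Fin 4 → ℂ) (ϖ : Matrix (Fin 4) (Fin 4) ℂ) (g : Momentum → ℂ) :
    Momentum → ℂ := fun p =>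
  let q := lorentzAct (lorentzPart b ϖ) p
  Complex.exp (I * mdot (translationPart b ϖ) (toC (onShell q))) * g q

/-- The thermal mean value `∫ d³p'/(2ε') ⟨a†_p a_{p'}⟩ g(p')` at imaginary thermal vorticity.
With `K = oneParticle b ϖ`, the cyclicity of the trace and
`[a_p, a†_{p'}] = 2ε δ³(𝐩 - 𝐩')` give the equation `N g = K (g + N g)` for this quantity `N g`;
its solution by iteration, starting from `0`, has the partial sums of `∑_{n ≥ 1} K^n g` as
successive approximations. -/
def occupation (b : Fin 4 → ℂ) (ϖ : Matrix (Fin 4) (Fin 4) ℂ) (g : Momentum → ℂ) :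
    Momentum → ℂ := fun p =>
  ∑' n : ℕ, ((oneParticle b ϖ)^[n + 1] g) p

/-- The plane wave `exp(- i p·x)` as a function of the on-shell momentum. -/
def planeWave (x : Fin 4 → ℝ) (p : Momentum) : ℂ :=
  Complex.exp (-I * mdot (toC (onShell p)) (toC x))

/-- The complex phase space distribution
`f_c(x,p) = (2π)⁻³ ∫ d³p'/(2ε') exp(i (p - p')·x) ⟨a†_p a_{p'}⟩`. -/
def phaseSpaceDensity (b : Fin 4 → ℂ) (ϖ : Matrix (Fin 4) (Fin 4) ℂ) (x : Fin 4 → ℝ)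
    (p : Momentum) : ℂ :=
  ((2 * Real.pi) ^ 3 : ℂ)⁻¹ *
    (Complex.exp (I * mdot (toC (onShell p)) (toC x)) * occupation b ϖ (planeWave x) p)

/-- `⟨:ψ²(x):⟩` at imaginary thermal vorticity, for the neutral massless field
`ψ(x) = (2π)^{-3/2} ∫ d³p/(2ε) [exp(-i p·x) a_p + exp(i p·x) a†_p]`. As `⟨a a⟩ = ⟨a† a†⟩ = 0` and
normal ordering turns both mixed products into `a†_p a_{p'}`, it is
`2 (2π)⁻³ ∫ d³p/(2ε) ∫ d³p'/(2ε') exp(i (p - p')·x) ⟨a†_p a_{p'}⟩ = ∫ d³p/ε f_c(x,p)`. -/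
def psiSqImag (b : Fin 4 → ℂ) (ϖ : Matrix (Fin 4) (Fin 4) ℂ) (x : Fin 4 → ℝ) : ℂ :=
  ∫ p : Momentum, (‖p‖ : ℂ)⁻¹ * phaseSpaceDensity b ϖ x p

/-! ### Analytic distillation -/

/-- `f(z) ~ ∑_n a_n (z - z₀)^n` as `z → z₀` in `D`, with finitely many negative powers. -/
def HasAsymptoticSeries (f : ℂ → ℂ) (D : Set ℂ) (z₀ : ℂ) (a : ℤ → ℂ) : Prop :=
  ∃ m : ℤ, (∀ n < m, a n = 0) ∧
    ∀ N : ℤ, (fun z => f z - ∑ n ∈ Finset.Icc m N, a n * (z - z₀) ^ n)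
      =o[𝓝[D \ {z₀}] z₀] fun z => (z - z₀) ^ N

/-- `F` is, near `z₀`, the analytic distillate in `z₀` of the function `f` on the domain `D`: `D` is
a finite union of subsets, each with `z₀` as an accumulation point, in each of which `f` has an
asymptotic power series; and the power series of the coefficients of nonnegative index which are
common to all of them (the others being replaced by `0`) has a positive radius of convergence, with
sum `F`. -/
def IsAnalyticDistillate (f : ℂ → ℂ) (D : Set ℂ) (z₀ : ℂ) (F : ℂ → ℂ) : Prop :=
  ∃ (k : ℕ) (S : Fin (k + 1) → Set ℂ) (a : Fin (k + 1) → ℤ → ℂ) (c : ℕ → ℂ),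
    (⋃ i, S i) = D ∧
    (∀ i, z₀ ∈ closure (S i \ {z₀})) ∧
    (∀ i, HasAsymptoticSeries f (S i) z₀ (a i)) ∧
    (∀ n : ℕ, (∀ i, a i n = a 0 n) → c n = a 0 n) ∧
    (∀ n : ℕ, ¬ (∀ i, a i n = a 0 n) → c n = 0) ∧
    HasFPowerSeriesAt F (FormalMultilinearSeries.ofScalars ℂ c) z₀

/-! ### Physical mean value: distillation and continuation to real thermal vorticity -/

/-- The imaginary thermal vorticity `- i ξ ϖ`, for real `ξ`. The value `ξ = i` would give back `ϖ`. -/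
def imagVorticity (ϖ : Matrix (Fin 4) (Fin 4) ℝ) (ξ : ℝ) : Matrix (Fin 4) (Fin 4) ℂ :=
  (-I * ξ) • ϖ.map (fun r : ℝ => (r : ℂ))

/-- The vector `b` for which, with the thermal vorticity `- i ξ ϖ`, the four-temperature at `x` is
the given `β`. -/
def shiftedB (β : Fin 4 → ℝ) (ϖ : Matrix (Fin 4) (Fin 4) ℝ) (x : Fin 4 → ℝ) (ξ : ℝ) : Fin 4 → ℂ :=
  toC β - (metric ℂ * imagVorticity ϖ ξ).mulVec (toC x)

/-- `⟨:ψ²(x):⟩_I` as a function of `ξ` (real), for the thermal vorticity `- i ξ ϖ` and with the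
four-temperature at `x` kept equal to its physical value `β(x) = b + ϖ·x`. -/
def psiSqRay (b : Fin 4 → ℝ) (ϖ : Matrix (Fin 4) (Fin 4) ℝ) (x : Fin 4 → ℝ) (ξ : ℝ) : ℂ :=
  psiSqImag (shiftedB (fourTemp b ϖ x) ϖ x ξ) (imagVorticity ϖ ξ) x

/-- `v` is the thermal expectation value `⟨:ψ²(x):⟩` at the global equilibrium
`exp[- b·P + ϖ:J/2] / Z` with real `b` and `ϖ`: the value at `ξ = i` of the analytic continuation,
along the straight segment from `0` to `i`, of the analytic distillate in `ξ = 0` of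
`⟨:ψ²(x):⟩_I`, a function of the real variable `ξ ≠ 0`. -/
def IsThermalPsiSq (b : Fin 4 → ℝ) (ϖ : Matrix (Fin 4) (Fin 4) ℝ) (x : Fin 4 → ℝ) (v : ℂ) : Prop :=
  ∃ F : ℂ → ℂ,
    IsAnalyticDistillate (fun ξ => psiSqRay b ϖ x ξ.re) {ξ | ξ.im = 0 ∧ ξ ≠ 0} 0 F ∧
    AnalyticOnNhd ℂ F (segment ℝ (0 : ℂ) I) ∧ F I = v

/-! ### Rotation and acceleration along the `z` axis -/

/-- `b = (1/T₀, 0, 0, 0)`. -/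
def bVec (T₀ : ℝ) : Fin 4 → ℝ := ![1 / T₀, 0, 0, 0]

/-- The covariant thermal vorticity with acceleration `a` and angular velocity `ω` along `z`:
`ϖ_{03} = - ϖ_{30} = a/T₀`, `ϖ_{12} = - ϖ_{21} = ω/T₀`. -/
def vorticity (T₀ a ω : ℝ) : Matrix (Fin 4) (Fin 4) ℝ :=
  !![0, 0, 0, a / T₀;
     0, 0, ω / T₀, 0;
     0, -(ω / T₀), 0, 0;
     -(a / T₀), 0, 0, 0]

end ThermalField

end

noncomputable section

namespace ThermalField

/-! ### Holomorphic functions near the real axis with quadratic decay -/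

/-! With `ϖ` replaced by `-iξϖ`, the density operator acts as a real boost-rotation combined with an
imaginary translation. Since `β(x)` is kept fixed, this affine flow can be centred at `x`. The
`n`-th iterate on one-particle states is the flow at time `n`, so the real phases cancel against the
plane waves. The `n`-th term of the iteration is then `exp(-B_n·p)`, where `B_n` is the
four-temperature accumulated along the inverse flow up to time `n`. Integrating this Boltzmann
factor over `d³p/ε` gives `4π/B_n²`. Hence `⟨:ψ²:⟩_I = (2π²)⁻¹ ∑_{n≥1} 1/B_n²`
(`psiSqImag_eq_tsum`).

The parameter `ξ` enters only as a step size: `ξ² B_n² = G(nξ)` for one even entire function `G`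
(`distSq`), with `G(z) = κz² + O(z⁴)` and `κ = β²` (`sq_mul_mdot_accTemp`). Write `1/G(z) = 1/(κz²)
+ h(z)`. Because `β` is time-like, `G(s) ≥ κs²` on the real axis, and `h` is even, holomorphic near
the axis and of quadratic decay (`stripDecay_distSqInvRem`). The first part sums to `ζ(2)/κ`. By
evenness, `∑_{n≥1} h(nξ)` is half of the sum over all integers minus `h(0)/2`. By Poisson summation,
the sum over all integers is `|ξ|⁻¹ ∫ h` up to every power of `ξ`. So `⟨:ψ²:⟩_I = p + c|ξ| + qξ²` to
all orders, with `q` proportional to `-h(0)` (`exists_psiSqImag_expansion`).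

The coefficient of degree one is `c` on the positive half-axis and `-c` on the negative one, so
distillation erases it. The distillate is the polynomial `p + qξ²`, for every admissible
decomposition of the domain, and its value at `ξ = i` is `p - q`. The constant `h(0)` comes from the
quartic coefficient of `G`, which is proportional to `α²`. This explains why `α·w` does not occur.
-/

/-- `h` is holomorphic in a uniform neighbourhood of the real axis, and decays there like the
inverse square of the real part. -/
def StripDecay (h : ℂ → ℂ) : Prop :=
  ∃ δ > 0, ∃ C : ℝ, ∀ s : ℝ, DifferentiableOn ℂ h (Metric.closedBall (s : ℂ) δ) ∧
    ∀ z ∈ Metric.closedBall (s : ℂ) δ, ‖h z‖ ≤ C * (1 + s ^ 2)⁻¹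

theorem StripDecay.analyticAt {h : ℂ → ℂ} (hh : StripDecay h) (s : ℝ) : AnalyticAt ℂ h s := by
  obtain ⟨δ, hδ, C, H⟩ := hh
  exact (H s).1.analyticAt (Metric.closedBall_mem_nhds _ hδ)

theorem StripDecay.hasDerivAt_iteratedDeriv {h : ℂ → ℂ} (hh : StripDecay h) (n : ℕ) (s : ℝ) :
    HasDerivAt (fun s : ℝ => iteratedDeriv n h s) (iteratedDeriv (n + 1) h s) s := by
  have h1 : AnalyticAt ℂ (iteratedDeriv n h) s := by
    rw [iteratedDeriv_eq_iterate]
    exact (hh.analyticAt s).iterated_deriv n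
  have h2 := h1.differentiableAt.hasDerivAt
  rw [← iteratedDeriv_succ] at h2
  exact h2.comp_ofReal

theorem StripDecay.iteratedDeriv_ofReal {h : ℂ → ℂ} (hh : StripDecay h) (n : ℕ) :
    iteratedDeriv n (fun s : ℝ => h s) = fun s : ℝ => iteratedDeriv n h s := by
  induction n with
  | zero => simp
  | succ n ih =>
    rw [iteratedDeriv_succ, ih]
    ext s
    exact (hh.hasDerivAt_iteratedDeriv n s).deriv

theorem StripDecay.contDiff {h : ℂ → ℂ} (hh : StripDecay h) (N : ℕ∞) :
    ContDiff ℝ N (fun s : ℝ => h s) := by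
  apply contDiff_of_differentiable_iteratedDeriv
  intro m _
  rw [hh.iteratedDeriv_ofReal]
  exact fun s => (hh.hasDerivAt_iteratedDeriv m s).differentiableAt

/-- Cauchy's estimate on the circle of fixed radius `δ` about `s` bounds every derivative by a
constant times `(1 + s²)⁻¹`. This is why the strip must have uniform width. -/
theorem StripDecay.integrable_iteratedDeriv {h : ℂ → ℂ} (hh : StripDecay h) (n : ℕ) :
    Integrable (iteratedDeriv n (fun s : ℝ => h s)) := by
  have hc : Continuous (iteratedDeriv n (fun s : ℝ => h s)) := by
    rw [hh.iteratedDeriv_ofReal]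
    exact continuous_iff_continuousAt.2 fun s => (hh.hasDerivAt_iteratedDeriv n s).continuousAt
  obtain ⟨δ, hδ, C, H⟩ := id hh
  refine (integrable_inv_one_add_sq.const_mul (n.factorial * C / δ ^ n)).mono'
    hc.aestronglyMeasurable (ae_of_all _ fun s => ?_)
  rw [hh.iteratedDeriv_ofReal]
  have hd : DiffContOnCl ℂ h (Metric.ball (s : ℂ) δ) :=
    DifferentiableOn.diffContOnCl ((H s).1.mono Metric.closure_ball_subset_closedBall)
  refine (Complex.norm_iteratedDeriv_le_of_forall_mem_sphere_norm_le n hδ hd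
    fun z hz => (H s).2 z (Metric.sphere_subset_closedBall hz)).trans (le_of_eq ?_)
  ring

theorem StripDecay.exists_norm_le {h : ℂ → ℂ} (hh : StripDecay h) :
    ∃ C : ℝ, ∀ s : ℝ, ‖h s‖ ≤ C * (1 + s ^ 2)⁻¹ := by
  obtain ⟨δ, hδ, C, H⟩ := hh
  exact ⟨C, fun s => (H s).2 s (Metric.mem_closedBall_self hδ.le)⟩

-- The transform of the `n`-th derivative is bounded by its `L¹` norm and equals `(2πiw)^n` times
-- the transform of `h`. Smoothness with integrable derivatives therefore gives decay of any
-- polynomial order.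
open FourierTransform in
theorem StripDecay.exists_norm_fourier_le {h : ℂ → ℂ} (hh : StripDecay h) (n : ℕ) :
    ∃ C : ℝ, 0 ≤ C ∧ ∀ w : ℝ, |w| ^ n * ‖𝓕 (fun s : ℝ => h s) w‖ ≤ C := by
  refine ⟨∫ s, ‖iteratedDeriv n (fun s : ℝ => h s) s‖, by positivity, fun w => ?_⟩
  have h1 := congrFun (Real.fourier_iteratedDeriv (hh.contDiff n)
    (fun m _ => hh.integrable_iteratedDeriv m) le_rfl) w
  have h2 : ‖𝓕 (iteratedDeriv n (fun s : ℝ => h s)) w‖ ≤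
      ∫ s, ‖iteratedDeriv n (fun s : ℝ => h s) s‖ :=
    VectorFourier.norm_fourierIntegral_le_integral_norm _ _ _ _ _
  refine le_trans ?_ h2
  rw [h1, norm_smul, norm_pow]
  gcongr
  simp only [norm_mul, Complex.norm_ofNat, norm_I, mul_one, Complex.norm_real, Real.norm_eq_abs,
    abs_of_pos Real.pi_pos]
  -- Only `2π ≥ 1` is needed; the surplus factor is dropped.
  have := Real.pi_gt_three
  nlinarith [abs_nonneg w]

open FourierTransform in
theorem fourier_comp_mul_left (f : ℝ → ℂ) {c : ℝ} (hc : c ≠ 0) (w : ℝ) :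
    𝓕 (fun s : ℝ => f (c * s)) w = (|c|⁻¹ : ℝ) * 𝓕 f (w / c) := by
  rw [Real.fourier_eq', Real.fourier_eq']
  have := Measure.integral_comp_mul_left
    (fun v : ℝ => Complex.exp (↑(-2 * Real.pi * inner ℝ v (w / c)) * I) • f v) c
  rw [abs_inv, Complex.real_smul] at this
  rw [← this]
  congr 1
  ext v
  congr 4
  simp
  field_simp

open FourierTransform in
/-- Poisson summation: up to an error smaller than any power, a Riemann sum over the whole line
is the integral. -/
theorem StripDecay.exists_norm_tsum_int_sub_le {h : ℂ → ℂ} (hh : StripDecay h) (N : ℕ) :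
    ∃ C : ℝ, ∀ ξ : ℝ, ξ ≠ 0 →
      ‖∑' n : ℤ, h ((n * ξ : ℝ) : ℂ) - (|ξ|⁻¹ : ℝ) * 𝓕 (fun s : ℝ => h s) 0‖ ≤
        C * |ξ| ^ (N + 1) := by
  -- The frequency `n` contributes `|ξ|⁻¹` times the transform at `n/ξ`. An order of decay `N + 2`
  -- leaves `|ξ|^(N+1)` after this loss and at least two powers of `1/n` for summability.
  obtain ⟨C, hC0, hC⟩ := hh.exists_norm_fourier_le (N + 2)
  obtain ⟨C', hC'⟩ := hh.exists_norm_le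
  have hcont : Continuous (fun s : ℝ => h s) := (hh.contDiff 0).continuous
  have hsum : Summable fun n : ℤ => C * ((1 : ℝ) / (n : ℝ) ^ 2) :=
    (Real.summable_one_div_int_pow.2 (by norm_num)).mul_left C
  refine ⟨∑' n : ℤ, C * ((1 : ℝ) / (n : ℝ) ^ 2), fun ξ hξ => ?_⟩
  have hξ' : 0 < |ξ| := abs_pos.2 hξ
  set f : ℝ → ℂ := fun s => h ((ξ * s : ℝ) : ℂ) with hf
  have hF : ∀ w, 𝓕 f w = (|ξ|⁻¹ : ℝ) * 𝓕 (fun s : ℝ => h s) (w / ξ) := fun w =>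
    fourier_comp_mul_left (fun s : ℝ => h s) hξ w
  have hbd : ∀ n : ℤ, n ≠ 0 → ‖𝓕 f n‖ ≤ (C * ((1 : ℝ) / (n : ℝ) ^ 2)) * |ξ| ^ (N + 1) := by
    intro n hn
    have hn1 : (1 : ℝ) ≤ |(n : ℝ)| := by
      have := Int.one_le_abs hn
      exact_mod_cast this
    have hn2 : (n : ℝ) ^ 2 = |(n : ℝ)| ^ 2 := (sq_abs _).symm
    have h1 := hC (n / ξ)
    rw [hF, norm_mul, Complex.norm_real, Real.norm_of_nonneg (by positivity)]
    rw [abs_div, div_pow, div_mul_eq_mul_div, div_le_iff₀ (by positivity)] at h1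
    have h2 : |(n : ℝ)| ^ 2 * ‖𝓕 (fun s : ℝ => h s) (n / ξ)‖ ≤ C * |ξ| ^ (N + 2) := by
      refine le_trans ?_ h1
      gcongr ?_ * _
      exact pow_le_pow_right₀ hn1 (by omega)
    rw [hn2, inv_mul_le_iff₀ hξ']
    have h3 : |ξ| * (C * (1 / |(n : ℝ)| ^ 2) * |ξ| ^ (N + 1)) = C * |ξ| ^ (N + 2) / |(n : ℝ)| ^ 2 := by
      field_simp
      ring
    rw [h3, le_div_iff₀ (by positivity), mul_comm]
    exact h2
  have hO : f =O[cocompact ℝ] fun x => |x| ^ (-2 : ℝ) := by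
    refine IsBigO.of_bound (C' / ξ ^ 2) ?_
    have hne : ∀ᶠ x : ℝ in cocompact ℝ, x ≠ 0 := by
      have := (isCompact_singleton (x := (0 : ℝ))).compl_mem_cocompact
      filter_upwards [this] with x hx using hx
    filter_upwards [hne] with x hx
    have hC0' : 0 ≤ C' := by simpa using (norm_nonneg _).trans (hC' 0)
    rw [Real.rpow_neg (abs_nonneg _), Real.rpow_two, sq_abs, norm_inv, norm_pow, Real.norm_eq_abs,
      sq_abs]
    refine (hC' _).trans ?_
    rw [div_eq_mul_inv, mul_assoc, ← mul_inv]
    gcongr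
    nlinarith
  have hs : Summable fun n : ℤ => 𝓕 f n := by
    refine Summable.of_norm_bounded_eventually (hsum.mul_right (|ξ| ^ (N + 1))) ?_
    filter_upwards [(Set.finite_singleton (0 : ℤ)).compl_mem_cofinite] with n hn using hbd n hn
  have hP := Real.tsum_eq_tsum_fourier_of_rpow_decay_of_summable (f := f)
    (hcont.comp (continuous_const.mul continuous_id))
    one_lt_two hO hs 0
  simp only [zero_add, QuotientAddGroup.mk_zero, fourier_eval_zero, mul_one] at hP
  have e1 : ∑' n : ℤ, h ((n * ξ : ℝ) : ℂ) = ∑' n : ℤ, f n := by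
    simp only [hf, mul_comm]
  have e2 := hs.tsum_eq_add_tsum_ite (0 : ℤ)
  rw [e1, hP, e2, hF, Int.cast_zero, zero_div, add_sub_cancel_left]
  refine tsum_of_norm_bounded (hsum.hasSum.mul_right (|ξ| ^ (N + 1))) fun n => ?_
  split_ifs with hn
  · rw [norm_zero]
    positivity
  · exact hbd n hn

/-! ### The entire fourth-order remainder of cosh -/

/-- The entire function `M` with `cosh z = 1 + z² / 2 + z⁴ M(z)`. -/
def coshRem (z : ℂ) : ℂ := if z = 0 then 1 / 24 else (cosh z - 1 - z ^ 2 / 2) / z ^ 4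

theorem coshRem_zero : coshRem 0 = 1 / 24 := if_pos rfl

theorem cosh_eq_coshRem (z : ℂ) : cosh z = 1 + z ^ 2 / 2 + z ^ 4 * coshRem z := by
  by_cases hz : z = 0
  · simp [hz]
  · rw [coshRem, if_neg hz]
    field_simp
    ring

theorem coshRem_neg (z : ℂ) : coshRem (-z) = coshRem z := by
  simp [coshRem, neg_eq_zero, Even.neg_pow (show Even 4 by decide)]

/-- The singularity at `0` is removable, so continuity there suffices. -/
theorem differentiable_coshRem : Differentiable ℂ coshRem := by
  have hpt : ∀ z : ℂ, z ≠ 0 → DifferentiableAt ℂ coshRem z := by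
    intro z hz
    have : DifferentiableAt ℂ (fun z : ℂ => (cosh z - 1 - z ^ 2 / 2) / z ^ 4) z := by
      refine DifferentiableAt.div (by fun_prop) (by fun_prop) (pow_ne_zero _ hz)
    refine this.congr_of_eventuallyEq ?_
    filter_upwards [isOpen_ne.mem_nhds hz] with w hw
    exact if_neg hw
  -- Adding the Taylor polynomials of `exp z` and `exp (-z)` with six terms reproduces `cosh`
  -- through `z⁴/24`, the odd terms cancelling. The error is of order `z⁶`, and division by `z⁴`
  -- leaves `z²`.
  have hbound : ∀ z : ℂ, ‖z‖ ≤ 1 → ‖coshRem z - coshRem 0‖ ≤ ‖z‖ ^ 2 := by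
    intro z hz
    by_cases h0 : z = 0
    · simp [h0]
    have h1 := Complex.exp_bound hz (n := 6) (by norm_num)
    have h2 := Complex.exp_bound (x := -z) (by simpa using hz) (n := 6) (by norm_num)
    rw [norm_neg] at h2
    have h3 : (coshRem z - coshRem 0) * z ^ 4 =
        ((exp z - ∑ m ∈ Finset.range 6, z ^ m / (m.factorial : ℂ)) +
        (exp (-z) - ∑ m ∈ Finset.range 6, (-z) ^ m / (m.factorial : ℂ))) / 2 := by
      have := cosh_eq_coshRem z
      rw [sub_mul, coshRem_zero, mul_comm (coshRem z), ← sub_eq_of_eq_add' this, Complex.cosh]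
      simp [Finset.sum_range_succ, Nat.factorial]
      ring
    have h4 : ‖coshRem z - coshRem 0‖ * ‖z‖ ^ 4 ≤ ‖z‖ ^ 2 * ‖z‖ ^ 4 := by
      rw [← norm_pow, ← norm_mul, h3, norm_div]
      have := norm_add_le (exp z - ∑ m ∈ Finset.range 6, z ^ m / (m.factorial : ℂ))
        (exp (-z) - ∑ m ∈ Finset.range 6, (-z) ^ m / (m.factorial : ℂ))
      have h5 : (0 : ℝ) ≤ ‖z‖ ^ 6 := by positivity
      norm_num [Nat.factorial] at h1 h2 ⊢
      norm_num [Finset.sum_range_succ, Nat.factorial] at h1 h2 this ⊢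
      nlinarith
    exact le_of_mul_le_mul_right h4 (by positivity)
  have hc : ContinuousAt coshRem 0 := by
    rw [ContinuousAt, tendsto_iff_norm_sub_tendsto_zero]
    refine squeeze_zero' (Eventually.of_forall fun _ => norm_nonneg _)
      (g := fun z => ‖z‖ ^ 2) ?_ ?_
    · filter_upwards [Metric.closedBall_mem_nhds (0 : ℂ) one_pos] with z hz
      exact hbound z (by simpa using hz)
    · have : Continuous fun z : ℂ => ‖z‖ ^ 2 := by fun_prop
      simpa using this.tendsto 0
  intro z
  by_cases hz : z = 0
  · subst hz
    refine (Complex.analyticAt_of_differentiable_on_punctured_nhds_of_continuousAt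
      ?_ hc).differentiableAt
    filter_upwards [self_mem_nhdsWithin] with w hw using hpt w hw
  · exact hpt z hz

/-! ### The square of the accumulated four-temperature -/

/-- The coefficient of `z⁴` in `distSq`, as an entire function of `z`. -/
def distSqRem (l r a ω : ℝ) (z : ℂ) : ℂ :=
  2 * l * a ^ 2 * coshRem (a * z) + 2 * r * ω ^ 4 * coshRem (ω * z * I)

/-- The holomorphic extension of `l σ(s)² - r τ(s)²`, where `σ(s) = 2 sinh(a s / 2) / a` and
`τ(s) = 2 sin(ω s / 2)`. -/
def distSq (l r a ω : ℝ) (z : ℂ) : ℂ :=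
  (l - r * ω ^ 2) * z ^ 2 + z ^ 4 * distSqRem l r a ω z

theorem distSq_eq (l r a ω : ℝ) (z : ℂ) : distSq l r a ω z =
    l * (z ^ 2 + 2 * a ^ 2 * z ^ 4 * coshRem (a * z)) - 2 * r * (1 - cos (ω * z)) := by
  have h : cos (ω * z) = 1 - ω ^ 2 * z ^ 2 / 2 + ω ^ 4 * z ^ 4 * coshRem (ω * z * I) := by
    rw [← cosh_mul_I, cosh_eq_coshRem]
    ring_nf
    rw [I_sq, I_pow_four]
    ring
  rw [h, distSq, distSqRem]
  ring

theorem normSq_sinh (z : ℂ) : ‖sinh z‖ ^ 2 = Real.sinh z.re ^ 2 + Real.sin z.im ^ 2 := by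
  conv_lhs => rw [← Complex.re_add_im z, Complex.sinh_add, sinh_mul_I, cosh_mul_I]
  rw [← ofReal_sinh, ← ofReal_cosh, ← ofReal_sin, ← ofReal_cos, ← normSq_eq_norm_sq, normSq_apply]
  simp only [add_re, add_im, mul_re, mul_im, ofReal_re, ofReal_im, I_re, I_im]
  linear_combination Real.sinh z.re ^ 2 * Real.sin_sq_add_cos_sq z.im +
    Real.sin z.im ^ 2 * Real.cosh_sq z.re

theorem normSq_sin (z : ℂ) : ‖sin z‖ ^ 2 = Real.sin z.re ^ 2 + Real.sinh z.im ^ 2 := by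
  have := normSq_sinh (z * I)
  rw [sinh_mul_I] at this
  simpa [add_comm] using this

theorem sq_le_sinh_sq (x : ℝ) : x ^ 2 ≤ Real.sinh x ^ 2 := by
  rcases le_total 0 x with h | h
  · have := Real.self_le_sinh_iff.2 h
    gcongr
  · have := Real.self_le_sinh_iff.2 (neg_nonneg.2 h)
    rw [Real.sinh_neg] at this
    nlinarith

theorem sin_sq_le_sq (x : ℝ) : Real.sin x ^ 2 ≤ x ^ 2 := by
  have := Real.abs_sin_le_abs (x := x)
  exact sq_le_sq.2 this

/-- The expression is `4 sinh²(az/2)/a²`, or `z²` when `a = 0`. The identity `|sinh w|² = sinh²(Re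
w) + sin²(Im w)` shows that leaving the real axis cannot make it smaller than `(Re z)²`. -/
theorem sq_re_le_norm_coshRem (a : ℝ) (z : ℂ) :
    z.re ^ 2 ≤ ‖z ^ 2 + 2 * a ^ 2 * z ^ 4 * coshRem (a * z)‖ := by
  by_cases ha : a = 0
  · have := Complex.abs_re_le_norm z
    rw [ha, ← sq_abs z.re, ofReal_zero, zero_pow two_ne_zero, mul_zero, zero_mul, zero_mul,
      add_zero, norm_pow]
    exact pow_le_pow_left₀ (abs_nonneg _) this 2
  · have h1 : z ^ 2 + 2 * a ^ 2 * z ^ 4 * coshRem (a * z) =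
        (4 / a ^ 2 : ℝ) * sinh (a * z / 2) ^ 2 := by
      have h2 := cosh_eq_coshRem (a * z)
      have h3 : cosh (a * z) = 1 + 2 * sinh (a * z / 2) ^ 2 := by
        have := cosh_two_mul (a * z / 2)
        rw [cosh_sq] at this
        rw [show (a : ℂ) * z = 2 * (a * z / 2) by ring, this]
        ring_nf
      have ha' : (a : ℂ) ≠ 0 := by exact_mod_cast ha
      rw [h3] at h2
      generalize sinh (a * z / 2) = S at h2 ⊢
      generalize coshRem (a * z) = m at h2 ⊢
      push_cast
      field_simp
      linear_combination (-2 : ℂ) * h2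
    rw [h1, norm_mul, norm_pow, normSq_sinh, norm_real, Real.norm_of_nonneg (by positivity)]
    have h4 := sq_le_sinh_sq ((a * z / 2).re)
    have h5 : (a * z / 2).re = a * z.re / 2 := by simp
    have : z.re ^ 2 = 4 / a ^ 2 * ((a * z / 2).re) ^ 2 := by
      rw [h5]; field_simp; ring
    rw [this]
    gcongr
    nlinarith [sq_nonneg (Real.sin (a * z / 2).im)]

/-- The hyperbolic part dominates `l (Re z)²`. The circular part obeys `|sin w|² = sin²(Re w) +
sinh²(Im w)`, so it costs at most `rω² (Re z)²` plus a term in `Im z` alone. That last term is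
uniformly small in a thin strip. -/
theorem norm_distSq_ge {l r a ω : ℝ} (hl : 0 ≤ l) (hr : 0 ≤ r) (z : ℂ) :
    (l - r * ω ^ 2) * z.re ^ 2 - 4 * r * Real.sinh (ω * z.im / 2) ^ 2 ≤ ‖distSq l r a ω z‖ := by
  rw [distSq_eq]
  refine le_trans ?_ (norm_sub_norm_le _ _)
  have h1 : ‖2 * (r : ℂ) * (1 - cos (ω * z))‖ =
      4 * r * (Real.sin (ω * z.re / 2) ^ 2 + Real.sinh (ω * z.im / 2) ^ 2) := by
    have : 1 - cos (ω * z) = 2 * sin (ω * z / 2) ^ 2 := by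
      have := cos_two_mul (ω * z / 2)
      rw [cos_sq'] at this
      rw [show (ω : ℂ) * z = 2 * (ω * z / 2) by ring, this]
      ring_nf
    rw [this, norm_mul, norm_mul, norm_mul, norm_pow, normSq_sin, norm_real,
      Real.norm_of_nonneg hr]
    simp
    ring
  rw [h1, norm_mul, norm_real, Real.norm_of_nonneg hl]
  have h2 := mul_le_mul_of_nonneg_left (sq_re_le_norm_coshRem a z) hl
  have h3 := mul_le_mul_of_nonneg_left (sin_sq_le_sq (ω * z.re / 2)) hr
  nlinarith

theorem differentiable_distSqRem (l r a ω : ℝ) : Differentiable ℂ (distSqRem l r a ω) := by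
  have h1 : Differentiable ℂ fun z : ℂ => coshRem (a * z) :=
    differentiable_coshRem.comp (by fun_prop)
  have h2 : Differentiable ℂ fun z : ℂ => coshRem (ω * z * I) :=
    differentiable_coshRem.comp (by fun_prop)
  exact (h1.const_mul _).add (h2.const_mul _)

theorem distSqRem_neg (l r a ω : ℝ) (z : ℂ) : distSqRem l r a ω (-z) = distSqRem l r a ω z := by
  simp only [distSqRem, mul_neg, neg_mul, coshRem_neg]

/-- The analytic function `1 / distSq z - 1 / ((l - r ω²) z²)`. -/
def distSqInvRem (l r a ω : ℝ) (z : ℂ) : ℂ :=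
  -distSqRem l r a ω z / ((l - r * ω ^ 2) * (l - r * ω ^ 2 + z ^ 2 * distSqRem l r a ω z))

theorem distSqInvRem_neg (l r a ω : ℝ) (z : ℂ) :
    distSqInvRem l r a ω (-z) = distSqInvRem l r a ω z := by
  simp only [distSqInvRem, distSqRem_neg, neg_sq]

theorem distSqInvRem_zero (l r a ω : ℝ) : distSqInvRem l r a ω 0 =
    -(l * a ^ 2 + r * ω ^ 4) / (12 * (l - r * ω ^ 2) ^ 2) := by
  simp only [distSqInvRem, distSqRem, mul_zero, zero_mul, coshRem_zero]
  by_cases h : (l : ℂ) - r * ω ^ 2 = 0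
  · simp [h]
  · field_simp
    ring

theorem distSqInvRem_eq {l r a ω : ℝ} (hk : 0 < l - r * ω ^ 2) {z : ℂ}
    (hz : distSq l r a ω z ≠ 0) :
    distSqInvRem l r a ω z = (distSq l r a ω z)⁻¹ - ((l - r * ω ^ 2) * z ^ 2)⁻¹ := by
  have hk' : (l : ℂ) - r * ω ^ 2 ≠ 0 := by exact_mod_cast hk.ne'
  have hd : distSq l r a ω z = z ^ 2 * (l - r * ω ^ 2 + z ^ 2 * distSqRem l r a ω z) := by
    rw [distSq]; ring
  rw [hd] at hz ⊢
  have hz1 : z ≠ 0 := fun h => hz (by rw [h]; ring)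
  have hz2 := right_ne_zero_of_mul hz
  rw [distSqInvRem]
  generalize (l : ℂ) - r * ω ^ 2 = κ at hk' hz2 ⊢
  rw [div_eq_iff (mul_ne_zero hk' hz2)]
  generalize distSqRem l r a ω z = m at hz2 ⊢
  have h1 : (z ^ 2 * (κ + z ^ 2 * m))⁻¹ * (κ * (κ + z ^ 2 * m)) = κ / z ^ 2 := by field_simp
  rw [sub_mul, h1]
  field_simp
  ring

theorem norm_distSq_ofReal_ge {l r : ℝ} (a ω : ℝ) (hl : 0 ≤ l) (hr : 0 ≤ r) (s : ℝ) :
    (l - r * ω ^ 2) * s ^ 2 ≤ ‖distSq l r a ω s‖ := by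
  simpa using norm_distSq_ge (a := a) (ω := ω) hl hr s

theorem distSqInvRem_differentiableAt {l r a ω : ℝ} (hk : 0 < l - r * ω ^ 2) {z : ℂ}
    (hz : l - r * ω ^ 2 + z ^ 2 * distSqRem l r a ω z ≠ 0) :
    DifferentiableAt ℂ (distSqInvRem l r a ω) z := by
  have hk' : (l : ℂ) - r * ω ^ 2 ≠ 0 := by exact_mod_cast hk.ne'
  have := differentiable_distSqRem l r a ω
  exact DifferentiableAt.div (by fun_prop) (by fun_prop) (mul_ne_zero hk' hz)

/-- Two regimes are used. Near a bounded piece of the axis, the denominator `κ + z² R(z)` has no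
zero on the axis: it equals `κ` at `0`, and elsewhere the real lower bound applies. By compactness
it has none nearby. Far out, both `1/G` and `1/(κz²)` are of order `(Re z)⁻²`. -/
theorem stripDecay_distSqInvRem {l r : ℝ} (a : ℝ) {ω : ℝ} (hl : 0 ≤ l) (hr : 0 ≤ r)
    (hk : 0 < l - r * ω ^ 2) : StripDecay (distSqInvRem l r a ω) := by
  set κ := l - r * ω ^ 2 with hκ
  have hm := differentiable_distSqRem l r a ω
  set g : ℂ → ℂ := fun z => l - r * ω ^ 2 + z ^ 2 * distSqRem l r a ω z with hg
  have hgc : Continuous g := by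
    have := hm.continuous
    fun_prop
  have hd : ∀ z, distSq l r a ω z = z ^ 2 * g z := fun z => by
    rw [distSq, hg]; ring
  -- nonvanishing near a compact piece of the axis
  set K : Set ℂ := (fun s : ℝ => (s : ℂ)) '' Set.Icc (-2) 2 with hK
  have hKc : IsCompact K := isCompact_Icc.image continuous_ofReal
  obtain ⟨δ₁, hδ₁, hsub⟩ := hKc.exists_cthickening_subset_open (isOpen_ne_fun hgc continuous_const)
    (t := {z | g z ≠ 0}) (by
      rintro _ ⟨s, -, rfl⟩ h0
      by_cases hs : s = 0
      · subst hs
        have : ((l - r * ω ^ 2 : ℝ) : ℂ) = 0 := by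
          push_cast; simpa [hg] using h0
        exact hk.ne' (by exact_mod_cast this)
      · have h1 := norm_distSq_ofReal_ge a ω hl hr s
        rw [hd, h0] at h1
        have : 0 < (l - r * ω ^ 2) * s ^ 2 := by positivity
        simp at h1
        linarith)
  have hTc : IsCompact (Metric.cthickening δ₁ K) := hKc.cthickening
  have hTd : ∀ z ∈ Metric.cthickening δ₁ K, DifferentiableAt ℂ (distSqInvRem l r a ω) z :=
    fun z hz => distSqInvRem_differentiableAt hk (hsub hz)
  obtain ⟨C₁, hC₁⟩ := hTc.exists_bound_of_continuousOn
    (f := distSqInvRem l r a ω) fun z hz => (hTd z hz).continuousAt.continuousWithinAt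
  -- width of the strip in which `distSq` dominates
  obtain ⟨δ₂, hδ₂, hsinh⟩ : ∃ δ₂ > 0, ∀ y : ℝ, |y| ≤ δ₂ →
      4 * r * Real.sinh (ω * y / 2) ^ 2 ≤ κ / 2 := by
    have hc : Continuous fun y : ℝ => 4 * r * Real.sinh (ω * y / 2) ^ 2 := by
      have := Real.continuous_sinh
      fun_prop
    have h0 := hc.tendsto 0
    simp only [mul_zero, zero_div, Real.sinh_zero, ne_eq, OfNat.ofNat_ne_zero, not_false_eq_true,
      zero_pow] at h0
    obtain ⟨ε, hε, h⟩ := Metric.eventually_nhds_iff.1 (h0.eventually (gt_mem_nhds (half_pos hk)))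
    refine ⟨ε / 2, half_pos hε, fun y hy => (h ?_).le⟩
    rw [Real.dist_eq, sub_zero]
    linarith
  -- Once `|Re z| ≥ 1`, the loss `κ/2` is at most half of the main term `κ (Re z)²`.
  have hbig : ∀ z : ℂ, 1 ≤ |z.re| → |z.im| ≤ δ₂ → κ / 2 * z.re ^ 2 ≤ ‖distSq l r a ω z‖ := by
    intro z hz1 hz2
    have h1 := norm_distSq_ge (a := a) (ω := ω) hl hr z
    have h2 := hsinh z.im hz2
    have h3 : 1 ≤ z.re ^ 2 := by
      rw [← sq_abs]; nlinarith
    nlinarith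
  set δ := min (min δ₁ δ₂) 1 with hδdef
  have hδ : 0 < δ := by positivity
  have hδ1 : δ ≤ δ₁ := (min_le_left _ _).trans (min_le_left _ _)
  have hδ2 : δ ≤ δ₂ := (min_le_left _ _).trans (min_le_right _ _)
  have hδ3 : δ ≤ 1 := min_le_right _ _
  -- For `|s| ≤ 2` one has `1 + s² ≤ 5`, whence `5|C₁|`. For `|s| > 2`, `(Re z)² ≥ (|s| - 1)² ≥ (1 +
  -- s²)/5`, and the two terms contribute `10/κ` and `5/κ`.
  have key : ∀ s : ℝ, ∀ z ∈ Metric.closedBall (s : ℂ) δ,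
      DifferentiableAt ℂ (distSqInvRem l r a ω) z ∧
        ‖distSqInvRem l r a ω z‖ ≤ (5 * |C₁| + 15 / κ) * (1 + s ^ 2)⁻¹ := by
    intro s z hz
    by_cases hs : |s| ≤ 2
    · have hzT : z ∈ Metric.cthickening δ₁ K := by
        refine Metric.mem_cthickening_of_dist_le z (s : ℂ) _ _ ⟨s, abs_le.1 hs, rfl⟩ ?_
        exact (Metric.mem_closedBall.1 hz).trans hδ1
      refine ⟨hTd z hzT, (hC₁ z hzT).trans ?_⟩
      rw [← div_eq_mul_inv, le_div_iff₀ (by positivity)]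
      have h1 : s ^ 2 ≤ 4 := by rw [← sq_abs]; nlinarith [abs_nonneg s]
      have h2 := le_abs_self C₁
      have h3 : 0 < 15 / κ := by positivity
      nlinarith [abs_nonneg C₁, sq_nonneg s]
    · push Not at hs
      rw [Metric.mem_closedBall, dist_eq] at hz
      have hre : |z.re - s| ≤ δ := by
        simpa using (abs_re_le_norm (z - s)).trans hz
      have him : |z.im| ≤ δ := by
        simpa using (abs_im_le_norm (z - s)).trans hz
      have hre1 : |s| - 1 ≤ |z.re| := by
        have := abs_sub_abs_le_abs_sub s z.re
        rw [abs_sub_comm] at this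
        linarith
      have h1 := hbig z (by linarith) (him.trans hδ2)
      have hre2 : (1 + s ^ 2) / 5 ≤ z.re ^ 2 := by
        rw [← sq_abs s, ← sq_abs z.re]
        nlinarith [abs_nonneg s]
      have hpos : 0 < (1 + s ^ 2) / 5 := by positivity
      have hzre : 0 < z.re ^ 2 := hpos.trans_le hre2
      have hz0 : distSq l r a ω z ≠ 0 := by
        have : 0 < κ / 2 * z.re ^ 2 := by positivity
        exact norm_pos_iff.1 (this.trans_le h1)
      have hg0 : g z ≠ 0 := by
        rw [hd] at hz0
        exact right_ne_zero_of_mul hz0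
      refine ⟨distSqInvRem_differentiableAt hk hg0, ?_⟩
      rw [distSqInvRem_eq hk hz0]
      refine (norm_sub_le _ _).trans ?_
      have hκn : ‖((l : ℂ) - r * ω ^ 2) * z ^ 2‖ = κ * ‖z‖ ^ 2 := by
        have : (l : ℂ) - r * ω ^ 2 = ((κ : ℝ) : ℂ) := by rw [hκ]; push_cast; rfl
        rw [this, norm_mul, norm_real, norm_pow, Real.norm_of_nonneg hk.le]
      have hzn : z.re ^ 2 ≤ ‖z‖ ^ 2 := by
        rw [← sq_abs]; exact pow_le_pow_left₀ (abs_nonneg _) (abs_re_le_norm z) 2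
      have b1 : ‖(distSq l r a ω z)⁻¹‖ ≤ (κ / 2 * ((1 + s ^ 2) / 5))⁻¹ := by
        rw [norm_inv]
        refine inv_anti₀ (by positivity) (le_trans ?_ h1)
        gcongr
      have b2 : ‖(((l : ℂ) - r * ω ^ 2) * z ^ 2)⁻¹‖ ≤ (κ * ((1 + s ^ 2) / 5))⁻¹ := by
        rw [norm_inv, hκn]
        refine inv_anti₀ (by positivity) ?_
        gcongr
        linarith
      have b3 : (κ / 2 * ((1 + s ^ 2) / 5))⁻¹ + (κ * ((1 + s ^ 2) / 5))⁻¹ =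
          15 / κ * (1 + s ^ 2)⁻¹ := by
        field_simp
        ring
      have b4 : 0 ≤ 5 * |C₁| * (1 + s ^ 2)⁻¹ := by positivity
      rw [add_mul]
      linarith
  exact ⟨δ, hδ, _, fun s => ⟨fun z hz => (key s z hz).1.differentiableWithinAt,
    fun z hz => (key s z hz).2⟩⟩

open FourierTransform in
/-- The asymptotic expansion for `ξ → 0` of the series of inverse squares of the accumulated
four-temperatures. -/
theorem exists_tsum_inv_distSq_expansion {l r : ℝ} (a : ℝ) {ω : ℝ} (hl : 0 ≤ l) (hr : 0 ≤ r)
    (hk : 0 < l - r * ω ^ 2) :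
    ∃ c : ℂ, ∀ N : ℕ, ∃ C : ℝ, ∀ ξ : ℝ, ξ ≠ 0 →
      ‖∑' n : ℕ, (ξ : ℂ) ^ 2 * (distSq l r a ω (((n + 1 : ℕ) * ξ : ℝ) : ℂ))⁻¹ -
        ((Real.pi ^ 2 / (6 * (l - r * ω ^ 2)) : ℝ) + c * |ξ| +
          ((l * a ^ 2 + r * ω ^ 4) / (24 * (l - r * ω ^ 2) ^ 2) : ℝ) * ξ ^ 2)‖ ≤
        C * |ξ| ^ (N + 3) := by
  have hS := stripDecay_distSqInvRem a hl hr hk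
  set h := distSqInvRem l r a ω with hh
  -- The sum over positive integers is half of the two-sided sum, so the coefficient of `|ξ|` is
  -- half of the integral of `h`.
  refine ⟨𝓕 (fun s : ℝ => h s) 0 / 2, fun N => ?_⟩
  obtain ⟨C', hC'⟩ := hS.exists_norm_le
  obtain ⟨C, hC⟩ := hS.exists_norm_tsum_int_sub_le N
  refine ⟨C / 2, fun ξ hξ => ?_⟩
  have hs : Summable fun n : ℕ => h (((n + 1 : ℕ) * ξ : ℝ) : ℂ) := by
    have h2 : Summable fun n : ℕ => (1 : ℝ) / ((n + 1 : ℕ) : ℝ) ^ 2 :=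
      (summable_nat_add_iff 1).2 (Real.summable_one_div_nat_pow.2 one_lt_two)
    refine Summable.of_norm_bounded (h2.mul_left (C' / ξ ^ 2)) fun n => (hC' _).trans ?_
    have hC0 : 0 ≤ C' := by simpa using (norm_nonneg _).trans (hC' 0)
    have : 0 < ((n + 1 : ℕ) : ℝ) := by positivity
    rw [div_mul_div_comm, mul_one, div_eq_mul_inv]
    gcongr
    nlinarith
  have hneg : ∀ n : ℕ, h ((((-((n : ℤ) + 1) : ℤ) : ℝ) * ξ : ℝ) : ℂ) =
      h (((n + 1 : ℕ) * ξ : ℝ) : ℂ) := fun n => by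
    rw [hh, ← distSqInvRem_neg]
    congr 1
    push_cast
    ring
  have hpos : ∀ n : ℕ, h (((((n : ℤ) + 1 : ℤ) : ℝ) * ξ : ℝ) : ℂ) =
      h (((n + 1 : ℕ) * ξ : ℝ) : ℂ) := fun n => by
    push_cast; rfl
  have hZ := tsum_of_add_one_of_neg_add_one (f := fun n : ℤ => h ((n * ξ : ℝ) : ℂ))
    (by simpa only [hpos] using hs) (by simpa only [hneg] using hs)
  simp only [hpos, hneg, Int.cast_zero, zero_mul, ofReal_zero] at hZ
  have hterm : ∀ n : ℕ, (ξ : ℂ) ^ 2 * (distSq l r a ω (((n + 1 : ℕ) * ξ : ℝ) : ℂ))⁻¹ =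
      (ξ : ℂ) ^ 2 * h (((n + 1 : ℕ) * ξ : ℝ) : ℂ) +
        ((l : ℂ) - r * ω ^ 2)⁻¹ * ((1 / ((n + 1 : ℕ) : ℝ) ^ 2 : ℝ) : ℂ) := by
    intro n
    have hn : 0 < ((n + 1 : ℕ) : ℝ) := by positivity
    have h0 : distSq l r a ω (((n + 1 : ℕ) * ξ : ℝ) : ℂ) ≠ 0 := by
      have := norm_distSq_ofReal_ge a ω hl hr ((n + 1 : ℕ) * ξ)
      have h1 : 0 < (l - r * ω ^ 2) * ((n + 1 : ℕ) * ξ) ^ 2 := by positivity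
      exact norm_pos_iff.1 (h1.trans_le this)
    have hξC : (ξ : ℂ) ≠ 0 := by exact_mod_cast hξ
    have hnC : (((n + 1 : ℕ) : ℝ) : ℂ) ≠ 0 := by exact_mod_cast hn.ne'
    have hkC : (l : ℂ) - r * ω ^ 2 ≠ 0 := by exact_mod_cast hk.ne'
    rw [hh, distSqInvRem_eq hk h0, mul_sub, sub_add, eq_comm, sub_eq_self, ofReal_div, ofReal_pow,
      ofReal_mul, ofReal_one]
    generalize (l : ℂ) - r * ω ^ 2 = κ at hkC ⊢
    field_simp
    ring
  have hzeta : HasSum (fun n : ℕ => 1 / ((n + 1 : ℕ) : ℝ) ^ 2) (Real.pi ^ 2 / 6) := by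
    have := (hasSum_nat_add_iff' (f := fun n : ℕ => 1 / (n : ℝ) ^ 2) 1).2 hasSum_zeta_two
    simpa using this
  have hzetaC := (Complex.hasSum_ofReal.2 hzeta).mul_left ((l : ℂ) - r * ω ^ 2)⁻¹
  have hsum := ((hs.hasSum.mul_left ((ξ : ℂ) ^ 2)).add hzetaC).tsum_eq
  simp only [hterm]
  rw [hsum]
  have hb := hC ξ hξ
  rw [hZ] at hb
  set T := ∑' n : ℕ, h (((n + 1 : ℕ) * ξ : ℝ) : ℂ) with hT
  set Fh := 𝓕 (fun s : ℝ => h s) 0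
  have h0 : h 0 = -(l * a ^ 2 + r * ω ^ 4) / (12 * (l - r * ω ^ 2) ^ 2) := distSqInvRem_zero ..
  have habs : ((ξ : ℂ)) ^ 2 = ((|ξ| : ℝ) : ℂ) ^ 2 := by
    rw [← ofReal_pow, ← ofReal_pow, sq_abs]
  have habs0 : ((|ξ| : ℝ) : ℂ) ≠ 0 := by exact_mod_cast (abs_pos.2 hξ).ne'
  -- The central value `h 0` of the two-sided sum is exactly what the `ξ²` coefficient compensates;
  -- what remains is `ξ²/2` times the Poisson error.
  have heq : (ξ : ℂ) ^ 2 * T + ((l : ℂ) - r * ω ^ 2)⁻¹ * ((Real.pi ^ 2 / 6 : ℝ) : ℂ) -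
      ((Real.pi ^ 2 / (6 * (l - r * ω ^ 2)) : ℝ) + Fh / 2 * |ξ| +
          ((l * a ^ 2 + r * ω ^ 4) / (24 * (l - r * ω ^ 2) ^ 2) : ℝ) * ξ ^ 2) =
      (ξ : ℂ) ^ 2 / 2 * (T + h 0 + T - (|ξ|⁻¹ : ℝ) * Fh) := by
    have hkC : (l : ℂ) - r * ω ^ 2 ≠ 0 := by exact_mod_cast hk.ne'
    rw [h0, habs]
    push_cast
    generalize (l : ℂ) - r * ω ^ 2 = κ at hkC ⊢
    field_simp
    ring
  rw [heq, norm_mul, norm_div, norm_pow, norm_real, Real.norm_eq_abs, Complex.norm_ofNat]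
  calc |ξ| ^ 2 / 2 * ‖T + h 0 + T - (|ξ|⁻¹ : ℝ) * Fh‖ ≤ |ξ| ^ 2 / 2 * (C * |ξ| ^ (N + 1)) := by
        gcongr
    _ = C / 2 * |ξ| ^ (N + 3) := by ring

/-! ### Distillates of functions of the form `p + c |ξ| + q ξ²` up to all orders -/

/-- Dividing by the lowest power `z^k` with a nonzero coefficient gives a limit equal to that
coefficient, while the little-o bound with `k ≤ N` forces the limit to be `0`. -/
theorem coeff_eq_zero_of_isLittleO {l : Filter ℂ} [l.NeBot] (hl : l ≤ 𝓝[≠] 0) {m N : ℤ}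
    {d : ℤ → ℂ} (h : (fun z : ℂ => ∑ n ∈ Finset.Icc m N, d n * z ^ n) =o[l] fun z => z ^ N) :
    ∀ n ∈ Finset.Icc m N, d n = 0 := by
  by_contra! hne
  obtain ⟨n₁, hn₁, hd₁⟩ := hne
  -- the lowest nonvanishing coefficient
  obtain ⟨k, hk, hmin⟩ := ((Finset.Icc m N).filter fun n => d n ≠ 0).exists_minimal
    ⟨n₁, Finset.mem_filter.2 ⟨hn₁, hd₁⟩⟩
  rw [Finset.mem_filter, Finset.mem_Icc] at hk
  have hlow : ∀ n ∈ Finset.Icc m N, n < k → d n = 0 := by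
    intro n hn hnk
    by_contra h0
    exact absurd (hmin (Finset.mem_filter.2 ⟨hn, h0⟩) hnk.le) (not_le.2 hnk)
  have hne0 : ∀ᶠ z in l, z ≠ 0 := hl self_mem_nhdsWithin
  have hto : Tendsto id l (𝓝 (0 : ℂ)) := hl.trans nhdsWithin_le_nhds
  have hpow : ∀ j : ℤ, 0 < j → Tendsto (fun z : ℂ => z ^ j) l (𝓝 0) := by
    intro j hj
    lift j to ℕ using hj.le
    have := (hto.pow j)
    rw [zero_pow (by omega)] at this
    simpa using this
  have h1 : Tendsto (fun z : ℂ => z ^ (-k) * ∑ n ∈ Finset.Icc m N, d n * z ^ n) l (𝓝 0) := by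
    have h2 : (fun z : ℂ => z ^ (-k) * ∑ n ∈ Finset.Icc m N, d n * z ^ n) =o[l]
        fun z => z ^ (-k) * z ^ N := (isBigO_refl _ _).mul_isLittleO h
    have h3 : (fun z : ℂ => z ^ (-k) * z ^ N) =O[l] fun _ => (1 : ℂ) := by
      rcases hk.1.2.eq_or_lt with hkN | hkN
      · refine IsBigO.of_bound 1 ?_
        filter_upwards [hne0] with z hz
        rw [← zpow_add₀ hz, hkN]
        simp
      · refine (Tendsto.isBigO_one ℂ (c := 0) ?_)
        refine (hpow (N - k) (by omega)).congr' ?_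
        filter_upwards [hne0] with z hz
        rw [← zpow_add₀ hz]
        congr 1; ring
    exact (isLittleO_one_iff ℂ).1 (h2.trans_isBigO h3)
  have h2 : Tendsto (fun z : ℂ => z ^ (-k) * ∑ n ∈ Finset.Icc m N, d n * z ^ n) l (𝓝 (d k)) := by
    have h3 : Tendsto (fun z : ℂ => ∑ n ∈ Finset.Icc m N, d n * z ^ (n - k)) l
        (𝓝 (∑ n ∈ Finset.Icc m N, if n = k then d k else 0)) := by
      refine tendsto_finsetSum _ fun n hn => ?_
      rcases lt_trichotomy n k with hlt | heq | hgt
      · simp [hlow n hn hlt, hlt.ne]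
      · simp [heq]
      · rw [if_neg hgt.ne']
        simpa using (hpow (n - k) (by omega)).const_mul (d n)
    rw [Finset.sum_ite_eq' (Finset.Icc m N) k, if_pos (Finset.mem_Icc.2 hk.1)] at h3
    refine h3.congr' ?_
    filter_upwards [hne0] with z hz
    rw [Finset.mul_sum]
    refine Finset.sum_congr rfl fun n _ => ?_
    rw [zpow_sub₀ hz, zpow_neg]
    field_simp
  exact hk.2 (tendsto_nhds_unique h2 h1)

/-- The coefficients of `p + c z + q z²`. -/
def quadCoeff (p c q : ℂ) (n : ℤ) : ℂ := if n = 0 then p else if n = 1 then c else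
  if n = 2 then q else 0

theorem sum_quadCoeff (p c q : ℂ) {m N : ℤ} (hm : m ≤ 0) (hN : 2 ≤ N) (z : ℂ) :
    ∑ n ∈ Finset.Icc m N, quadCoeff p c q n * z ^ n = p + c * z + q * z ^ 2 := by
  have hsub : ({0, 1, 2} : Finset ℤ) ⊆ Finset.Icc m N := by
    intro n hn
    simp only [Finset.mem_insert, Finset.mem_singleton] at hn
    rw [Finset.mem_Icc]
    omega
  rw [← Finset.sum_subset hsub]
  · simp [quadCoeff, add_assoc]
  · intro n _ hn
    simp only [Finset.mem_insert, Finset.mem_singleton, not_or] at hn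
    simp [quadCoeff, hn]

/-- A function with the expansion `p + c z + q z²` up to all orders has no other asymptotic
coefficients. -/
theorem asymptotic_coeff_eq {l : Filter ℂ} [l.NeBot] (hl : l ≤ 𝓝[≠] 0) {f : ℂ → ℂ} {p c q : ℂ}
    (hf : ∀ N : ℕ, (fun z => f z - (p + c * z + q * z ^ 2)) =o[l] fun z => z ^ N)
    {m : ℤ} {a : ℤ → ℂ} (ha0 : ∀ n < m, a n = 0)
    (ha : ∀ N : ℤ, (fun z => f z - ∑ n ∈ Finset.Icc m N, a n * z ^ n) =o[l] fun z => z ^ N)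
    (n : ℤ) : a n = quadCoeff p c q n := by
  -- The window from `M` to `N` must contain the index `n`, all of the quadratic polynomial, and
  -- every possibly nonzero `a j` up to `N`.
  set M := min m (min n 0) with hM
  set N : ℕ := (max n 2).toNat with hN
  have hN2 : (2 : ℤ) ≤ N := by omega
  have h1 := (hf N).sub (by simpa only [zpow_natCast] using ha N)
  have hsum : ∀ z : ℂ, ∑ n ∈ Finset.Icc m (N : ℤ), a n * z ^ n =
      ∑ n ∈ Finset.Icc M (N : ℤ), a n * z ^ n := by
    intro z
    refine Finset.sum_subset (Finset.Icc_subset_Icc_left (by omega)) fun j hj hj' => ?_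
    rw [Finset.mem_Icc] at hj hj'
    rw [ha0 j (by omega), zero_mul]
  have h2 : (fun z : ℂ => ∑ j ∈ Finset.Icc M (N : ℤ), (a j - quadCoeff p c q j) * z ^ j) =o[l]
      fun z => z ^ (N : ℤ) := by
    simp only [zpow_natCast]
    refine h1.congr_left fun z => ?_
    simp only [sub_mul, Finset.sum_sub_distrib]
    rw [sum_quadCoeff p c q (by omega) hN2, hsum]
    ring
  exact sub_eq_zero.1 (coeff_eq_zero_of_isLittleO hl h2 n (Finset.mem_Icc.2 (by omega)))

theorem hasAsymptoticSeries_quadCoeff {f : ℂ → ℂ} {D : Set ℂ} {p c q : ℂ}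
    (hf : ∀ N : ℕ, (fun z => f z - (p + c * z + q * z ^ 2)) =o[𝓝[D \ {0}] 0] fun z => z ^ N) :
    HasAsymptoticSeries f D 0 (quadCoeff p c q) := by
  refine ⟨0, fun n hn => ?_, fun N => ?_⟩
  · simp only [quadCoeff]
    rw [if_neg, if_neg, if_neg] <;> omega
  · simp only [sub_zero]
    set K : ℕ := (max N 2).toNat + 1 with hK
    have hne0 : ∀ᶠ z in 𝓝[D \ {0}] (0 : ℂ), z ≠ 0 := by
      filter_upwards [self_mem_nhdsWithin] with z hz using hz.2
    have hto : Tendsto id (𝓝[D \ {0}] (0 : ℂ)) (𝓝 (0 : ℂ)) := nhdsWithin_le_nhds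
    have hpow : ∀ j : ℤ, N < j → (fun z : ℂ => z ^ j) =o[𝓝[D \ {0}] 0] fun z => z ^ N := by
      intro j hj
      obtain ⟨i, hi⟩ := Int.le.dest hj.le
      rw [isLittleO_iff_tendsto' (by
        filter_upwards [hne0] with z hz h using absurd h (zpow_ne_zero _ hz))]
      have h1 := hto.pow i
      rw [zero_pow (by omega)] at h1
      refine h1.congr' ?_
      filter_upwards [hne0] with z hz
      rw [← zpow_sub₀ hz, ← hi, add_sub_cancel_left, zpow_natCast]
      rfl
    have h1 : (fun z => f z - (p + c * z + q * z ^ 2)) =o[𝓝[D \ {0}] 0] fun z => z ^ N := by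
      refine (hf K).trans ?_
      have := hpow K (by omega)
      simpa only [zpow_natCast] using this
    -- For `N < 2` the truncated sum omits quadratic terms, but these have degree above `N` and are
    -- negligible. The `if` removes the negative indices that appear when `N < 0`.
    have h2 : (fun z : ℂ => ∑ n ∈ Finset.Ioc N K, (if 0 ≤ n then quadCoeff p c q n else 0) * z ^ n)
        =o[𝓝[D \ {0}] 0] fun z => z ^ N :=
      IsLittleO.fun_sum fun n hn => (hpow n (Finset.mem_Ioc.1 hn).1).const_mul_left _
    refine (h1.add h2).congr_left fun z => ?_
    rw [← sum_quadCoeff p c q (m := 0) (N := K) le_rfl (by omega)]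
    have h3 : ∑ n ∈ Finset.Icc 0 (K : ℤ), quadCoeff p c q n * z ^ n =
        ∑ n ∈ Finset.Icc 0 N, quadCoeff p c q n * z ^ n +
        ∑ n ∈ Finset.Ioc N (K : ℤ), (if 0 ≤ n then quadCoeff p c q n else 0) * z ^ n := by
      simp only [ite_mul, zero_mul]
      rw [← Finset.sum_filter, ← Finset.sum_union]
      · congr 1
        ext n
        simp only [Finset.mem_Icc, Finset.mem_union, Finset.mem_filter, Finset.mem_Ioc]
        omega
      · rw [Finset.disjoint_left]
        intro n
        simp only [Finset.mem_Icc, Finset.mem_filter, Finset.mem_Ioc]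
        omega
    rw [h3]
    ring

/-- On a half-axis `|ξ|` equals `σξ`, so the non-analytic term becomes an ordinary linear term whose
sign depends on the side. -/
theorem isLittleO_of_bound_on_ray {g : ℝ → ℂ} {p c q : ℂ}
    (hg : ∀ N : ℕ, ∃ C : ℝ, ∀ ξ : ℝ, ξ ≠ 0 →
      ‖g ξ - (p + c * |ξ| + q * ξ ^ 2)‖ ≤ C * |ξ| ^ (N + 3))
    {D : Set ℂ} (σ : ℝ) (hD : ∀ z ∈ D, z ≠ 0 ∧ z.im = 0 ∧ |z.re| = σ * z.re) (N : ℕ) :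
    (fun z : ℂ => g z.re - (p + (c * σ) * z + q * z ^ 2)) =o[𝓝[D] 0] fun z => z ^ N := by
  obtain ⟨C, hC⟩ := hg N
  have h1 : (fun z : ℂ => g z.re - (p + (c * σ) * z + q * z ^ 2)) =O[𝓝[D] 0]
      fun z => z ^ (N + 3) := by
    refine IsBigO.of_bound C ?_
    filter_upwards [self_mem_nhdsWithin] with z hz
    obtain ⟨h0, him, habs⟩ := hD z hz
    have hz' : z = (z.re : ℂ) := Complex.ext rfl (by simpa using him)
    have hre : z.re ≠ 0 := fun h => h0 (by rw [hz', h, ofReal_zero])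
    have h2 := hC z.re hre
    rw [norm_pow]
    have h3 : ‖z‖ = |z.re| := by
      conv_lhs => rw [hz']
      simp
    rw [h3]
    refine le_trans (le_of_eq ?_) h2
    rw [habs, ofReal_mul, ← hz', mul_assoc]
  refine h1.trans_isLittleO ?_
  exact ((isLittleO_pow_pow (𝕜 := ℂ) (show N < N + 3 by omega)).mono nhdsWithin_le_nhds)

theorem hasFPowerSeriesAt_quad (p q : ℂ) : HasFPowerSeriesAt (fun z : ℂ => p + q * z ^ 2)
    (FormalMultilinearSeries.ofScalars ℂ fun n : ℕ => quadCoeff p 0 q n) 0 := by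
  rw [hasFPowerSeriesAt_iff]
  refine Eventually.of_forall fun z => ?_
  have h := hasSum_sum_of_ne_finset_zero (s := Finset.range 3)
    (L := SummationFilter.unconditional ℕ) (f := fun n : ℕ => z ^ n • quadCoeff p 0 q n) (fun n hn => by
      rw [Finset.mem_range] at hn
      rw [quadCoeff, if_neg, if_neg, if_neg, smul_zero] <;> omega)
  have hc : ∀ n : ℕ, (FormalMultilinearSeries.ofScalars ℂ fun n : ℕ => quadCoeff p 0 q n).coeff n =
      quadCoeff p 0 q n := fun n => FormalMultilinearSeries.coeff_ofScalars
  simp_rw [hc, zero_add]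
  have h2 : ∑ n ∈ Finset.range 3, z ^ n • quadCoeff p 0 q n = p + q * z ^ 2 := by
    simp [Finset.sum_range_succ, quadCoeff, mul_comm]
  rwa [h2] at h

theorem quadCoeff_eq_of_ne_one (p c q : ℂ) (n : ℤ) (hn : n ≠ 1) (c' : ℂ) :
    quadCoeff p c q n = quadCoeff p c' q n := by
  simp [quadCoeff, hn]

theorem quadCoeff_one (p c q : ℂ) : quadCoeff p c q 1 = c := by
  simp [quadCoeff]

/-- The positive (`σ = 1`) or negative (`σ = -1`) real half-axis in the complex plane. -/
def halfAxis (σ : ℝ) : Set ℂ := {z | z.im = 0 ∧ 0 < σ * z.re}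

theorem halfAxis_spec {σ : ℝ} (hσ : |σ| = 1) (z : ℂ) (hz : z ∈ halfAxis σ) :
    z ≠ 0 ∧ z.im = 0 ∧ |z.re| = σ * z.re := by
  refine ⟨fun h => ?_, hz.1, ?_⟩
  · have := hz.2
    simp [h] at this
  · rw [← abs_of_pos hz.2, abs_mul, hσ, one_mul]

theorem halfAxis_union : halfAxis 1 ∪ halfAxis (-1) = {ξ : ℂ | ξ.im = 0 ∧ ξ ≠ 0} := by
  ext z
  simp only [halfAxis, Set.mem_union, Set.mem_ofPred_eq, one_mul, neg_mul, Left.neg_pos_iff,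
    ← and_or_left]
  refine and_congr_right fun h => ?_
  rw [or_comm, lt_or_lt_iff_ne, ne_eq, ne_eq, Complex.ext_iff]
  simp [h]

theorem zero_mem_closure_halfAxis {σ : ℝ} (hσ : |σ| = 1) : (0 : ℂ) ∈ closure (halfAxis σ) := by
  have h1 : Tendsto (fun n : ℕ => ((σ * (1 / ((n : ℝ) + 1)) : ℝ) : ℂ)) atTop (𝓝 0) := by
    have := (tendsto_one_div_add_atTop_nhds_zero_nat (𝕜 := ℝ)).const_mul σ
    rw [mul_zero] at this
    exact_mod_cast (Complex.continuous_ofReal.tendsto 0).comp this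
  refine mem_closure_of_tendsto h1 (Eventually.of_forall fun n => ⟨ofReal_im _, ?_⟩)
  have h2 : σ * σ = 1 := by rw [← abs_mul_abs_self, hσ, one_mul]
  rw [ofReal_re, ← mul_assoc, h2, one_mul]
  positivity

/-- The distillate forgets the coefficient of `|ξ|`. -/
theorem isAnalyticDistillate_of_bound {g : ℝ → ℂ} {p c q : ℂ}
    (hg : ∀ N : ℕ, ∃ C : ℝ, ∀ ξ : ℝ, ξ ≠ 0 →
      ‖g ξ - (p + c * |ξ| + q * ξ ^ 2)‖ ≤ C * |ξ| ^ (N + 3)) :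
    IsAnalyticDistillate (fun ξ => g ξ.re) {ξ | ξ.im = 0 ∧ ξ ≠ 0} 0
      fun z => p + q * z ^ 2 := by
  have hσ : ∀ i : Fin 2, |(![1, -1] : Fin 2 → ℝ) i| = 1 := by
    intro i; fin_cases i <;> simp
  have hdiff : ∀ i : Fin 2, halfAxis ((![1, -1] : Fin 2 → ℝ) i) \ {0} =
      halfAxis ((![1, -1] : Fin 2 → ℝ) i) := fun i =>
    Set.sdiff_singleton_eq_self fun h => (halfAxis_spec (hσ i) 0 h).1 rfl
  refine ⟨1, fun i => halfAxis ((![1, -1] : Fin 2 → ℝ) i),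
    fun i => quadCoeff p (c * ((![1, -1] : Fin 2 → ℝ) i : ℝ)) q, fun n => quadCoeff p 0 q n,
    ?_, ?_, ?_, ?_, ?_, hasFPowerSeriesAt_quad p q⟩
  · rw [← halfAxis_union]
    ext z
    simp [Fin.exists_fin_two]
  · intro i
    rw [hdiff i]
    exact zero_mem_closure_halfAxis (hσ i)
  · intro i
    refine hasAsymptoticSeries_quadCoeff fun N => ?_
    rw [hdiff i]
    exact isLittleO_of_bound_on_ray hg _ (halfAxis_spec (hσ i)) N
  · intro n hn
    by_cases h1 : (n : ℤ) = 1
    -- If the linear coefficients `c` and `-c` agree, both vanish, so the value `0` is also right in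
    -- this case.
    · have h2 := hn 1
      simp only [h1, quadCoeff_one, Matrix.cons_val_zero, Matrix.cons_val_one, ofReal_neg,
        ofReal_one] at h2 ⊢
      linear_combination (1 / 2 : ℂ) * h2
    · exact quadCoeff_eq_of_ne_one _ _ _ _ h1 _
  · intro n hn
    by_cases h1 : (n : ℤ) = 1
    · simp only [h1, quadCoeff_one]
    · exact absurd (fun i => quadCoeff_eq_of_ne_one _ _ _ _ h1 _) hn

/-- The decomposition is arbitrary, but every piece accumulates at `0` along at least one half-axis,
which fixes all its coefficients except the sign of the linear one. Each half-axis is in turn met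
near `0` by some piece, so both `c` and `-c` occur, and a common linear coefficient must be `0`. -/
theorem IsAnalyticDistillate.eventuallyEq_of_bound {g : ℝ → ℂ} {p c q : ℂ}
    (hg : ∀ N : ℕ, ∃ C : ℝ, ∀ ξ : ℝ, ξ ≠ 0 →
      ‖g ξ - (p + c * |ξ| + q * ξ ^ 2)‖ ≤ C * |ξ| ^ (N + 3)) {F : ℂ → ℂ}
    (hF : IsAnalyticDistillate (fun ξ => g ξ.re) {ξ | ξ.im = 0 ∧ ξ ≠ 0} 0 F) :
    F =ᶠ[𝓝 0] fun z => p + q * z ^ 2 := by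
  obtain ⟨k, S, a, d, hS, hcl, has, hd1, hd2, hFs⟩ := hF
  have hray : ∀ σ : ℝ, |σ| = 1 → ∀ i, (𝓝[S i ∩ halfAxis σ] (0 : ℂ)).NeBot →
      ∀ n, a i n = quadCoeff p (c * σ) q n := by
    intro σ hσ i hne n
    obtain ⟨m, hm, hser⟩ := has i
    have hsub : S i ∩ halfAxis σ ⊆ S i \ {0} := fun z hz => ⟨hz.1, (halfAxis_spec hσ z hz.2).1⟩
    refine asymptotic_coeff_eq (l := 𝓝[S i ∩ halfAxis σ] 0) (f := fun ξ => g ξ.re)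
      (nhdsWithin_mono _ fun z hz => (hsub hz).2)
      (fun N => isLittleO_of_bound_on_ray hg σ (fun z hz => halfAxis_spec hσ z hz.2) N) hm
      (fun N => ?_) n
    have := (hser N).mono (nhdsWithin_mono _ hsub)
    simpa only [sub_zero] using this
  -- Finiteness of the decomposition enters here: a finite union of sets not accumulating at `0`
  -- does not accumulate there.
  have hex : ∀ σ : ℝ, |σ| = 1 → ∃ i, (𝓝[S i ∩ halfAxis σ] (0 : ℂ)).NeBot := by
    intro σ hσ
    by_contra! hall
    have h1 : halfAxis σ = ⋃ i, S i ∩ halfAxis σ := by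
      rw [← Set.iUnion_inter, hS, eq_comm, Set.inter_eq_right]
      exact fun z hz => ⟨hz.1, (halfAxis_spec hσ z hz).1⟩
    have h2 := mem_closure_iff_nhdsWithin_neBot.1 (zero_mem_closure_halfAxis hσ)
    rw [h1, nhdsWithin_iUnion] at h2
    refine h2.ne ?_
    simp only [iSup_eq_bot]
    exact fun i => by simpa [neBot_iff] using hall i
  have hone : ∀ i, ∃ σ : ℝ, |σ| = 1 ∧ (𝓝[S i ∩ halfAxis σ] (0 : ℂ)).NeBot := by
    intro i
    have h1 := mem_closure_iff_nhdsWithin_neBot.1 (hcl i)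
    have h2 : S i \ {0} ⊆ (S i ∩ halfAxis 1) ∪ (S i ∩ halfAxis (-1)) := by
      rw [← Set.inter_union_distrib_left, halfAxis_union, ← hS]
      exact fun z hz => ⟨hz.1, Set.mem_iUnion_of_mem i hz.1⟩
    have h3 := h1.mono (nhdsWithin_mono _ h2)
    rw [nhdsWithin_union, sup_neBot] at h3
    rcases h3 with h | h
    · exact ⟨1, by simp, h⟩
    · exact ⟨-1, by simp, h⟩
  have hd : d = fun n : ℕ => quadCoeff p 0 q n := by
    ext n
    by_cases h1 : (n : ℤ) = 1
    · rw [h1, quadCoeff_one]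
      by_cases hcom : ∀ i, a i n = a 0 n
      · obtain ⟨i, hi⟩ := hex 1 (by simp)
        obtain ⟨j, hj⟩ := hex (-1) (by simp)
        have e1 := hray 1 (by simp) i hi n
        have e2 := hray (-1) (by simp) j hj n
        rw [hcom, h1, quadCoeff_one] at e1 e2
        rw [hd1 n hcom, h1]
        push_cast at e1 e2
        linear_combination (1 / 2 : ℂ) * (e1 + e2)
      · exact hd2 n hcom
    · have h2 : ∀ i, a i n = quadCoeff p 0 q n := by
        intro i
        obtain ⟨σ, hσ, hi⟩ := hone i
        rw [hray σ hσ i hi n]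
        exact quadCoeff_eq_of_ne_one _ _ _ _ h1 _
      rw [hd1 n fun i => by rw [h2, h2], h2]
  rw [hd] at hFs
  have h1 := hasFPowerSeriesAt_iff.1 hFs
  have h2 := hasFPowerSeriesAt_iff.1 (hasFPowerSeriesAt_quad p q)
  filter_upwards [h1, h2] with z hz1 hz2
  simpa using hz1.unique hz2

/-- The value at `ξ = i` of the continued distillate. -/
theorem distillate_continuation_iff {g : ℝ → ℂ} {p c q : ℂ}
    (hg : ∀ N : ℕ, ∃ C : ℝ, ∀ ξ : ℝ, ξ ≠ 0 →
      ‖g ξ - (p + c * |ξ| + q * ξ ^ 2)‖ ≤ C * |ξ| ^ (N + 3)) (v : ℂ) :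
    (∃ F : ℂ → ℂ, IsAnalyticDistillate (fun ξ => g ξ.re) {ξ | ξ.im = 0 ∧ ξ ≠ 0} 0 F ∧
      AnalyticOnNhd ℂ F (segment ℝ (0 : ℂ) I) ∧ F I = v) ↔ v = p - q := by
  have hA : AnalyticOnNhd ℂ (fun z : ℂ => p + q * z ^ 2) (segment ℝ (0 : ℂ) I) :=
    fun z _ => by fun_prop
  constructor
  · rintro ⟨F, hF, hFa, rfl⟩
    -- The identity theorem on the connected segment makes the continuation unique.
    have := hFa.eqOn_of_preconnected_of_eventuallyEq hA (convex_segment _ _).isPreconnected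
      (left_mem_segment ℝ _ _) (hF.eventuallyEq_of_bound hg) (right_mem_segment ℝ _ _)
    simp only [this, I_sq]
    ring
  · rintro rfl
    refine ⟨_, isAnalyticDistillate_of_bound hg, hA, ?_⟩
    simp only [I_sq]
    ring

/-! ### The momentum integral of an exponential -/

/-- Rotating the first axis onto `v` makes the Boltzmann integrand a function of one component and
the norm. -/
theorem exists_orthonormalBasis_inner_eq (v : Momentum) :
    ∃ b : OrthonormalBasis (Fin 3) ℝ Momentum, ∀ p, inner ℝ v p = ‖v‖ * b.repr p 0 := by
  by_cases hv : v = 0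
  · exact ⟨EuclideanSpace.basisFun (Fin 3) ℝ, fun p => by simp [hv]⟩
  · have hv' : ‖v‖ ≠ 0 := norm_ne_zero_iff.2 hv
    obtain ⟨b, hb⟩ := Orthonormal.exists_orthonormalBasis_extension_of_card_eq (𝕜 := ℝ)
      (E := Momentum) (ι := Fin 3) (by simp) (v := fun _ => ‖v‖⁻¹ • v) (s := {0})
      ⟨fun i => by simp [norm_smul, hv'], fun i j hij => absurd (Subsingleton.elim i j) hij⟩
    refine ⟨b, fun p => ?_⟩
    rw [b.repr_apply_apply, hb 0 rfl, inner_smul_left]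
    simp [hv']

/-- Cylindrical coordinates about the first axis. With values in `ENNReal`, Tonelli applies without
prior integrability, so the same computation later yields both integrability and value. -/
theorem lintegral_momentum_eq (f : ℝ → ℝ → ENNReal) (hf : Measurable (Function.uncurry f)) :
    ∫⁻ p : Momentum, f (p 0) ‖p‖ =
      ENNReal.ofReal (2 * Real.pi) *
        ∫⁻ x : ℝ, ∫⁻ ρ in Set.Ioi (0 : ℝ), ENNReal.ofReal ρ * f x √(x ^ 2 + ρ ^ 2) := by
  have h1 : ∫⁻ p : Momentum, f (p 0) ‖p‖ =
      ∫⁻ q : Fin 3 → ℝ, f (q 0) √(q 0 ^ 2 + (q 1 ^ 2 + q 2 ^ 2)) := by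
    rw [← (EuclideanSpace.volume_preserving_symm_measurableEquiv_toLp (Fin 3)).lintegral_comp_emb
      (MeasurableEquiv.measurableEmbedding _)]
    refine lintegral_congr fun p => ?_
    rw [EuclideanSpace.norm_eq]
    simp [Fin.sum_univ_three, add_assoc]
  have h2 : ∫⁻ q : Fin 3 → ℝ, f (q 0) √(q 0 ^ 2 + (q 1 ^ 2 + q 2 ^ 2)) =
      ∫⁻ q : ℝ × (Fin 2 → ℝ), f q.1 √(q.1 ^ 2 + (q.2 0 ^ 2 + q.2 1 ^ 2)) := by
    rw [← (volume_preserving_piFinSuccAbove (fun _ : Fin 3 => ℝ) 0).lintegral_comp_emb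
      (MeasurableEquiv.measurableEmbedding _)]
    rfl
  have hm : Measurable fun q : ℝ × (Fin 2 → ℝ) => f q.1 √(q.1 ^ 2 + (q.2 0 ^ 2 + q.2 1 ^ 2)) := by
    have : Measurable fun q : ℝ × (Fin 2 → ℝ) => (q.1, √(q.1 ^ 2 + (q.2 0 ^ 2 + q.2 1 ^ 2))) := by
      fun_prop
    exact hf.comp this
  have h3 : ∀ x : ℝ, ∫⁻ q : Fin 2 → ℝ, f x √(x ^ 2 + (q 0 ^ 2 + q 1 ^ 2)) =
      ∫⁻ q : ℝ × ℝ, f x √(x ^ 2 + (q.1 ^ 2 + q.2 ^ 2)) := by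
    intro x
    rw [← (volume_preserving_finTwoArrow ℝ).lintegral_comp_emb
      (MeasurableEquiv.measurableEmbedding _)]
    rfl
  have h4 : ∀ x : ℝ, ∫⁻ q : ℝ × ℝ, f x √(x ^ 2 + (q.1 ^ 2 + q.2 ^ 2)) =
      ENNReal.ofReal (2 * Real.pi) *
        ∫⁻ ρ in Set.Ioi (0 : ℝ), ENNReal.ofReal ρ * f x √(x ^ 2 + ρ ^ 2) := by
    intro x
    rw [← lintegral_comp_polarCoord_symm, polarCoord_target, Measure.volume_eq_prod,
      ← Measure.prod_restrict, lintegral_prod]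
    · have : ∀ ρ θ : ℝ, ENNReal.ofReal (ρ, θ).1 • f x √(x ^ 2 +
          ((polarCoord.symm (ρ, θ)).1 ^ 2 + (polarCoord.symm (ρ, θ)).2 ^ 2)) =
          ENNReal.ofReal ρ * f x √(x ^ 2 + ρ ^ 2) := by
        intro ρ θ
        rw [polarCoord_symm_apply]
        simp only [smul_eq_mul]
        congr 4
        linear_combination ρ ^ 2 * Real.sin_sq_add_cos_sq θ
      simp only [this, lintegral_const, Measure.restrict_apply MeasurableSet.univ, Set.univ_inter,
        Real.volume_Ioo, sub_neg_eq_add, ← two_mul]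
      rw [lintegral_mul_const', mul_comm]
      exact ENNReal.ofReal_ne_top
    · have h5 : Measurable fun q : ℝ × ℝ => (x, √(x ^ 2 +
          ((polarCoord.symm q).1 ^ 2 + (polarCoord.symm q).2 ^ 2))) := by
        have := continuous_polarCoord_symm.measurable
        fun_prop
      have h6 := hf.comp h5
      exact ((ENNReal.measurable_ofReal.comp measurable_fst).mul h6).aemeasurable
  rw [h1, h2, Measure.volume_eq_prod, lintegral_prod _ hm.aemeasurable]
  simp only [h3, h4]
  rw [lintegral_const_mul' _ _ ENNReal.ofReal_ne_top]

/-- The invariant weight `1/ε` makes the integrand an exact derivative, since `ρ/√(x² + ρ²)` is the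
`ρ`-derivative of `√(x² + ρ²)`. -/
theorem lintegral_radial_exp {B : ℝ} (hB : 0 < B) (x : ℝ) :
    ∫⁻ ρ in Set.Ioi (0 : ℝ), ENNReal.ofReal (ρ * ((√(x ^ 2 + ρ ^ 2))⁻¹ *
      Real.exp (-(B * √(x ^ 2 + ρ ^ 2))))) = ENNReal.ofReal (Real.exp (-(B * |x|)) / B) := by
  set g : ℝ → ℝ := fun ρ => -Real.exp (-(B * √(x ^ 2 + ρ ^ 2))) / B with hg
  have hgc : Continuous g := by fun_prop
  have hd : ∀ ρ ∈ Set.Ioi (0 : ℝ), HasDerivAt g (ρ * ((√(x ^ 2 + ρ ^ 2))⁻¹ *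
      Real.exp (-(B * √(x ^ 2 + ρ ^ 2))))) ρ := by
    intro ρ hρ
    have hρ' : (0 : ℝ) < ρ := hρ
    have hpos : 0 < x ^ 2 + ρ ^ 2 := by positivity
    have h1 : HasDerivAt (fun ρ : ℝ => x ^ 2 + ρ ^ 2) (2 * ρ) ρ := by
      simpa using (hasDerivAt_pow 2 ρ).const_add (x ^ 2)
    have h2 := ((((h1.sqrt hpos.ne').const_mul B).neg.exp).neg).div_const B
    refine h2.congr_deriv ?_
    have := Real.sqrt_pos.2 hpos
    field_simp
    rfl
  have hnn : ∀ ρ ∈ Set.Ioi (0 : ℝ), 0 ≤ ρ * ((√(x ^ 2 + ρ ^ 2))⁻¹ *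
      Real.exp (-(B * √(x ^ 2 + ρ ^ 2)))) := by
    intro ρ hρ
    have hρ' : (0 : ℝ) < ρ := hρ
    positivity
  have hlim : Tendsto g atTop (𝓝 0) := by
    have h1 : Tendsto (fun ρ : ℝ => B * √(x ^ 2 + ρ ^ 2)) atTop atTop := by
      refine Tendsto.const_mul_atTop hB ?_
      refine tendsto_atTop_mono (fun ρ => ?_) tendsto_id
      exact Real.le_sqrt_of_sq_le (by simpa using sq_nonneg x)
    have h2 := ((Real.tendsto_exp_neg_atTop_nhds_zero.comp h1).neg).div_const B
    simpa using h2
  have hint := integrableOn_Ioi_deriv_of_nonneg hgc.continuousWithinAt hd hnn hlim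
  have hval := integral_Ioi_of_hasDerivAt_of_nonneg hgc.continuousWithinAt hd hnn hlim
  rw [← ofReal_integral_eq_lintegral_ofReal hint, hval]
  · rw [hg]
    congr 1
    simp [Real.sqrt_sq_eq_abs]
    ring
  · exact (ae_restrict_iff' measurableSet_Ioi).2 (ae_of_all _ hnn)

theorem lintegral_exp_abs {B c : ℝ} (hc : |c| < B) :
    ∫⁻ x : ℝ, ENNReal.ofReal (Real.exp (c * x) * (Real.exp (-(B * |x|)) / B)) =
      ENNReal.ofReal (2 / (B ^ 2 - c ^ 2)) := by
  obtain ⟨h1, h2⟩ := abs_lt.1 hc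
  have hB : 0 < B := (abs_nonneg c).trans_lt hc
  have e1 : ∫⁻ x in Set.Ioi (0 : ℝ), ENNReal.ofReal
      (Real.exp (c * x) * (Real.exp (-(B * |x|)) / B)) = ENNReal.ofReal (1 / (B - c) / B) := by
    have h3 : c - B < 0 := by linarith
    have h4 : ∀ x ∈ Set.Ioi (0 : ℝ), ENNReal.ofReal (Real.exp (c * x) *
        (Real.exp (-(B * |x|)) / B)) = ENNReal.ofReal (Real.exp ((c - B) * x) / B) := by
      intro x hx
      rw [abs_of_pos hx, ← mul_div_assoc, ← Real.exp_add]
      ring_nf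
    rw [setLIntegral_congr_fun measurableSet_Ioi h4, ← ofReal_integral_eq_lintegral_ofReal
      ((integrableOn_exp_mul_Ioi h3 0).div_const B) (ae_of_all _ fun x => by positivity),
      integral_div, integral_exp_mul_Ioi h3, mul_zero, Real.exp_zero, neg_div, ← div_neg, neg_sub]
  have e2 : ∫⁻ x in Set.Iic (0 : ℝ), ENNReal.ofReal
      (Real.exp (c * x) * (Real.exp (-(B * |x|)) / B)) = ENNReal.ofReal (1 / (B + c) / B) := by
    have h3 : 0 < B + c := by linarith
    have h4 : ∀ x ∈ Set.Iic (0 : ℝ), ENNReal.ofReal (Real.exp (c * x) *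
        (Real.exp (-(B * |x|)) / B)) = ENNReal.ofReal (Real.exp ((B + c) * x) / B) := by
      intro x hx
      rw [abs_of_nonpos hx, ← mul_div_assoc, ← Real.exp_add]
      ring_nf
    rw [setLIntegral_congr_fun measurableSet_Iic h4, ← ofReal_integral_eq_lintegral_ofReal
      ((integrableOn_exp_mul_Iic h3 0).div_const B) (ae_of_all _ fun x => by positivity),
      integral_div, integral_exp_mul_Iic h3, mul_zero, Real.exp_zero]
  rw [← lintegral_add_compl _ (measurableSet_Ioi (a := (0 : ℝ))), Set.compl_Ioi, e1, e2,
    ← ENNReal.ofReal_add]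
  · congr 1
    have h3 : B - c ≠ 0 := by linarith
    have h4 : B + c ≠ 0 := by linarith
    have h5 : B ^ 2 - c ^ 2 = (B - c) * (B + c) := by ring
    rw [h5]
    field_simp
    ring
  · have : 0 < B - c := by linarith
    positivity
  · have : 0 < B + c := by linarith
    positivity

/-- The momentum integral of a relativistic Boltzmann distribution. -/
theorem lintegral_boltzmann {B : ℝ} {v : Momentum} (hv : ‖v‖ < B) :
    ∫⁻ p : Momentum, ENNReal.ofReal (‖p‖⁻¹ * Real.exp (-(B * ‖p‖ - inner ℝ v p))) =
      ENNReal.ofReal (4 * Real.pi / (B ^ 2 - ‖v‖ ^ 2)) := by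
  have hB : 0 < B := (norm_nonneg v).trans_lt hv
  obtain ⟨b, hb⟩ := exists_orthonormalBasis_inner_eq v
  set f : ℝ → ℝ → ENNReal := fun x s =>
    ENNReal.ofReal (s⁻¹ * Real.exp (-(B * s - ‖v‖ * x))) with hf
  have h1 : ∫⁻ p : Momentum, ENNReal.ofReal (‖p‖⁻¹ * Real.exp (-(B * ‖p‖ - inner ℝ v p))) =
      ∫⁻ p : Momentum, f (p 0) ‖p‖ := by
    rw [← b.measurePreserving_repr.lintegral_comp_emb
      b.repr.toHomeomorph.toMeasurableEquiv.measurableEmbedding (fun p => f (p 0) ‖p‖)]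
    refine lintegral_congr fun p => ?_
    rw [hb, hf, LinearIsometryEquiv.norm_map]
  rw [h1, lintegral_momentum_eq f (by rw [hf]; simp only [Function.uncurry_def]; fun_prop)]
  have h2 : ∀ x : ℝ, ∫⁻ ρ in Set.Ioi (0 : ℝ), ENNReal.ofReal ρ * f x √(x ^ 2 + ρ ^ 2) =
      ENNReal.ofReal (Real.exp (‖v‖ * x) * (Real.exp (-(B * |x|)) / B)) := by
    intro x
    rw [ENNReal.ofReal_mul (by positivity), ← lintegral_radial_exp hB x,
      ← lintegral_const_mul' _ _ ENNReal.ofReal_ne_top]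
    refine setLIntegral_congr_fun measurableSet_Ioi fun ρ hρ => ?_
    have hρ' : (0 : ℝ) < ρ := hρ
    rw [hf, ← ENNReal.ofReal_mul hρ'.le, ← ENNReal.ofReal_mul (by positivity)]
    congr 1
    rw [neg_sub, sub_eq_add_neg, Real.exp_add]
    ring
  simp only [h2]
  rw [lintegral_exp_abs (by rwa [abs_norm]), ← ENNReal.ofReal_mul (by positivity)]
  congr 1
  ring

theorem integrable_boltzmann {B : ℝ} {v : Momentum} (hv : ‖v‖ < B) :
    Integrable fun p : Momentum => ‖p‖⁻¹ * Real.exp (-(B * ‖p‖ - inner ℝ v p)) := by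
  refine ⟨by fun_prop, ?_⟩
  rw [hasFiniteIntegral_iff_ofReal (ae_of_all _ fun p => by positivity), lintegral_boltzmann hv]
  exact ENNReal.ofReal_lt_top

theorem integral_boltzmann {B : ℝ} {v : Momentum} (hv : ‖v‖ < B) :
    ∫ p : Momentum, ‖p‖⁻¹ * Real.exp (-(B * ‖p‖ - inner ℝ v p)) =
      4 * Real.pi / (B ^ 2 - ‖v‖ ^ 2) := by
  rw [integral_eq_lintegral_of_nonneg_ae (ae_of_all _ fun p => by positivity) (by fun_prop),
    lintegral_boltzmann hv, ENNReal.toReal_ofReal]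
  have : 0 < B ^ 2 - ‖v‖ ^ 2 := by nlinarith [norm_nonneg v]
  positivity

/-! ### One-parameter groups of matrices -/

theorem hasDerivAt_exp_smul_matrix {n : Type*} [Fintype n] [DecidableEq n] (M : Matrix n n ℂ)
    (s : ℝ) (i j : n) :
    HasDerivAt (fun u : ℝ => NormedSpace.exp (u • M) i j)
      ((NormedSpace.exp (s • M) * M) i j) s := by
  let _ : NormedRing (Matrix n n ℂ) := Matrix.linftyOpNormedRing
  let _ : NormedAlgebra ℝ (Matrix n n ℂ) := Matrix.linftyOpNormedAlgebra
  have h := hasDerivAt_exp_smul_const M s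
  let e : Matrix n n ℂ →L[ℝ] ℂ :=
    LinearMap.toContinuousLinearMap (Matrix.entryLinearMap ℝ ℂ i j)
  exact e.hasFDerivAt.comp_hasDerivAt s h

/-- A solution of `E' = M E` with `E(0) = 1` is the one-parameter group generated by `M`. -/
theorem eq_exp_smul_of_hasDerivAt {n : Type*} [Fintype n] [DecidableEq n] (M : Matrix n n ℂ)
    (E : ℝ → Matrix n n ℂ) (hE : ∀ s i j, HasDerivAt (fun u => E u i j) ((M * E s) i j) s)
    (h0 : E 0 = 1) (s : ℝ) : E s = NormedSpace.exp (s • M) := by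
  have hconst : ∀ s : ℝ, NormedSpace.exp (s • -M) * E s = 1 := by
    intro s
    ext i j
    have hd : ∀ u : ℝ, HasDerivAt (fun u : ℝ => (NormedSpace.exp (u • -M) * E u) i j) 0 u := by
      intro u
      have h1 : HasDerivAt (fun u : ℝ => ∑ k, NormedSpace.exp (u • -M) i k * E u k j)
          (∑ k, ((NormedSpace.exp (u • -M) * -M) i k * E u k j +
            NormedSpace.exp (u • -M) i k * (M * E u) k j)) u :=
        HasDerivAt.fun_sum fun k _ => (hasDerivAt_exp_smul_matrix (-M) u i k).mul (hE u k j)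
      have h2 : ∑ k, ((NormedSpace.exp (u • -M) * -M) i k * E u k j +
          NormedSpace.exp (u • -M) i k * (M * E u) k j) =
          (NormedSpace.exp (u • -M) * -M * E u + NormedSpace.exp (u • -M) * (M * E u)) i j := by
        rw [Finset.sum_add_distrib, Matrix.add_apply, Matrix.mul_apply, Matrix.mul_apply]
      rw [h2] at h1
      have h3 : NormedSpace.exp (u • -M) * -M * E u + NormedSpace.exp (u • -M) * (M * E u) = 0 := by
        rw [mul_neg, neg_mul, mul_assoc, neg_add_cancel]
      rw [h3] at h1
      exact h1
    have := is_const_of_deriv_eq_zero (fun u => (hd u).differentiableAt)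
      (fun u => (hd u).deriv) s 0
    rw [this, h0]
    simp
  have h1 : NormedSpace.exp (s • M) * NormedSpace.exp (s • -M) = 1 := by
    rw [smul_neg, ← Matrix.exp_add_of_commute _ _ (Commute.refl (s • M)).neg_right,
      add_neg_cancel, NormedSpace.exp_zero]
  calc E s = NormedSpace.exp (s • M) * NormedSpace.exp (s • -M) * E s := by rw [h1, one_mul]
    _ = NormedSpace.exp (s • M) := by rw [mul_assoc, hconst, mul_one]

/-! ### Primitives of hyperbolic and circular functions -/

/-- `∫₀ˢ cosh (k u) du`. -/
def coshInt (k s : ℝ) : ℝ := if k = 0 then s else Real.sinh (k * s) / k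

/-- `∫₀ˢ sinh (k u) du`. -/
def sinhInt (k s : ℝ) : ℝ := if k = 0 then 0 else (Real.cosh (k * s) - 1) / k

/-- `∫₀ˢ cos (k u) du`. -/
def cosInt (k s : ℝ) : ℝ := if k = 0 then s else Real.sin (k * s) / k

/-- `∫₀ˢ sin (k u) du`. -/
def sinInt (k s : ℝ) : ℝ := if k = 0 then 0 else (1 - Real.cos (k * s)) / k

theorem hasDerivAt_coshInt (k s : ℝ) : HasDerivAt (coshInt k) (Real.cosh (k * s)) s := by
  by_cases hk : k = 0
  · unfold coshInt
    simpa [hk] using hasDerivAt_id' s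
  · have h := (((hasDerivAt_id s).const_mul k).sinh).div_const k
    unfold coshInt
    simpa [hk, mul_div_assoc] using! h

theorem hasDerivAt_sinhInt (k s : ℝ) : HasDerivAt (sinhInt k) (Real.sinh (k * s)) s := by
  by_cases hk : k = 0
  · unfold sinhInt
    simpa [hk] using hasDerivAt_const s (0 : ℝ)
  · have h := ((((hasDerivAt_id s).const_mul k).cosh).sub_const 1).div_const k
    unfold sinhInt
    simpa [hk, mul_div_assoc] using! h

theorem hasDerivAt_cosInt (k s : ℝ) : HasDerivAt (cosInt k) (Real.cos (k * s)) s := by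
  by_cases hk : k = 0
  · unfold cosInt
    simpa [hk] using hasDerivAt_id' s
  · have h := (((hasDerivAt_id s).const_mul k).sin).div_const k
    unfold cosInt
    simpa [hk, mul_div_assoc] using! h

theorem hasDerivAt_sinInt (k s : ℝ) : HasDerivAt (sinInt k) (Real.sin (k * s)) s := by
  by_cases hk : k = 0
  · unfold sinInt
    simpa [hk] using hasDerivAt_const s (0 : ℝ)
  · have h := ((((hasDerivAt_id s).const_mul k).cos).const_sub 1).div_const k
    unfold sinInt
    simpa [hk, mul_div_assoc] using! h

theorem mul_coshInt (k s : ℝ) : k * coshInt k s = Real.sinh (k * s) := by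
  by_cases hk : k = 0 <;> simp [coshInt, hk]
  field_simp

theorem mul_sinhInt (k s : ℝ) : k * sinhInt k s = Real.cosh (k * s) - 1 := by
  by_cases hk : k = 0 <;> simp [sinhInt, hk]
  field_simp

theorem mul_cosInt (k s : ℝ) : k * cosInt k s = Real.sin (k * s) := by
  by_cases hk : k = 0 <;> simp [cosInt, hk]
  field_simp

theorem mul_sinInt (k s : ℝ) : k * sinInt k s = 1 - Real.cos (k * s) := by
  by_cases hk : k = 0 <;> simp [sinInt, hk]
  field_simp

/-- This identity and the next three are integrated addition formulas. Together they say `exp(-sA)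
∫₀ˢ exp(uA) du = ∫₀ˢ exp(-uA) du`. -/
theorem cosh_mul_coshInt_sub (k s : ℝ) :
    Real.cosh (k * s) * coshInt k s - Real.sinh (k * s) * sinhInt k s = coshInt k s := by
  by_cases hk : k = 0
  · simp [coshInt, hk]
  · simp only [coshInt, sinhInt, hk, if_false]
    field_simp
    ring

theorem cosh_mul_sinhInt_sub (k s : ℝ) :
    Real.cosh (k * s) * sinhInt k s - Real.sinh (k * s) * coshInt k s = -sinhInt k s := by
  by_cases hk : k = 0
  · simp [sinhInt, hk]
  · simp only [coshInt, sinhInt, hk, if_false]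
    field_simp
    linear_combination Real.cosh_sq (k * s)

theorem cos_mul_cosInt_add (k s : ℝ) :
    Real.cos (k * s) * cosInt k s + Real.sin (k * s) * sinInt k s = cosInt k s := by
  by_cases hk : k = 0
  · simp [cosInt, hk]
  · simp only [cosInt, sinInt, hk, if_false]
    field_simp
    ring

theorem sin_mul_cosInt_sub (k s : ℝ) :
    Real.sin (k * s) * cosInt k s - Real.cos (k * s) * sinInt k s = sinInt k s := by
  by_cases hk : k = 0
  · simp [sinInt, hk]
  · simp only [cosInt, sinInt, hk, if_false]
    field_simp
    linear_combination Real.sin_sq_add_cos_sq (k * s)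

/-- The left side is `4 sinh²(ks/2)/k²`; the entire remainder `coshRem` covers `k = 0` by the same
formula. -/
theorem coshInt_sq_sub_sinhInt_sq (k s : ℝ) :
    ((coshInt k s ^ 2 - sinhInt k s ^ 2 : ℝ) : ℂ) =
      s ^ 2 + 2 * k ^ 2 * s ^ 4 * coshRem (k * s) := by
  by_cases hk : k = 0
  · simp [coshInt, sinhInt, hk]
  · have h := cosh_eq_coshRem (k * s)
    have h1 : (k : ℂ) ≠ 0 := by exact_mod_cast hk
    have h2 : coshInt k s ^ 2 - sinhInt k s ^ 2 = 2 * (Real.cosh (k * s) - 1) / k ^ 2 := by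
      simp only [coshInt, sinhInt, hk, if_false]
      field_simp
      linear_combination -Real.cosh_sq (k * s)
    rw [h2]
    push_cast
    rw [h]
    generalize coshRem (k * s) = m
    field_simp
    ring

theorem sq_le_coshInt_sq_sub (k s : ℝ) : s ^ 2 ≤ coshInt k s ^ 2 - sinhInt k s ^ 2 := by
  by_cases hk : k = 0
  · simp [coshInt, sinhInt, hk]
  · have h2 : coshInt k s ^ 2 - sinhInt k s ^ 2 = 4 * Real.sinh (k * s / 2) ^ 2 / k ^ 2 := by
      have h3 : Real.cosh (k * s) = 1 + 2 * Real.sinh (k * s / 2) ^ 2 := by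
        have := Real.cosh_two_mul (k * s / 2)
        rw [Real.cosh_sq, mul_div_cancel₀ _ two_ne_zero] at this
        linarith
      have h4 := Real.cosh_sq (k * s)
      simp only [coshInt, sinhInt, hk, if_false]
      field_simp
      linear_combination -h4 + 2 * h3
    have h5 := sq_le_sinh_sq (k * s / 2)
    rw [h2, le_div_iff₀ (by positivity)]
    nlinarith

theorem cosInt_sq_add_sinInt_sq (k s : ℝ) :
    k ^ 2 * (cosInt k s ^ 2 + sinInt k s ^ 2) = 2 * (1 - Real.cos (k * s)) := by
  have h1 := mul_cosInt k s
  have h2 := mul_sinInt k s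
  rw [mul_add, ← mul_pow, ← mul_pow, h1, h2]
  linear_combination Real.sin_sq_add_cos_sq (k * s)

theorem cosInt_sq_add_le (k s : ℝ) : cosInt k s ^ 2 + sinInt k s ^ 2 ≤ s ^ 2 := by
  by_cases hk : k = 0
  · simp [cosInt, sinInt, hk]
  · have h1 := cosInt_sq_add_sinInt_sq k s
    have h2 := Real.one_sub_sq_div_two_le_cos (x := k * s)
    have h3 : 0 < k ^ 2 := by positivity
    refine le_of_mul_le_mul_left ?_ h3
    rw [h1]
    nlinarith

theorem coshInt_pos (k : ℝ) {s : ℝ} (hs : 0 < s) : 0 < coshInt k s := by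
  rw [coshInt]
  split_ifs with hk
  · exact hs
  · rcases lt_or_gt_of_ne hk with h | h
    · exact div_pos_of_neg_of_neg (Real.sinh_neg_iff.2 (mul_neg_of_neg_of_pos h hs)) h
    · exact div_pos (Real.sinh_pos_iff.2 (mul_pos h hs)) h

/-! ### The commuting boosts and rotations along the `z` axis -/

/-- The generator of boosts with rapidity rate `k` and rotations with angular rate `m`. -/
def boostRotGen (k m : ℝ) : Matrix (Fin 4) (Fin 4) ℝ :=
  !![0, 0, 0, k; 0, 0, -m, 0; 0, m, 0, 0; k, 0, 0, 0]

/-- The one-parameter group `exp (s boostRotGen)`. -/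
def boostRot (k m s : ℝ) : Matrix (Fin 4) (Fin 4) ℝ :=
  !![Real.cosh (k * s), 0, 0, Real.sinh (k * s);
     0, Real.cos (m * s), -Real.sin (m * s), 0;
     0, Real.sin (m * s), Real.cos (m * s), 0;
     Real.sinh (k * s), 0, 0, Real.cosh (k * s)]

/-- `∫₀ˢ exp (u boostRotGen) β du`. -/
def boostRotInt (k m s : ℝ) (β : Fin 4 → ℝ) : Fin 4 → ℝ :=
  ![coshInt k s * β 0 + sinhInt k s * β 3, cosInt m s * β 1 - sinInt m s * β 2,
    sinInt m s * β 1 + cosInt m s * β 2, sinhInt k s * β 0 + coshInt k s * β 3]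

/-- `∫₀ˢ exp (-u boostRotGen) β du`, the four-temperature accumulated along the flow. -/
def accTemp (k m s : ℝ) (β : Fin 4 → ℝ) : Fin 4 → ℝ :=
  ![coshInt k s * β 0 - sinhInt k s * β 3, cosInt m s * β 1 + sinInt m s * β 2,
    -sinInt m s * β 1 + cosInt m s * β 2, -sinhInt k s * β 0 + coshInt k s * β 3]

theorem hasDerivAt_boostRot (k m s : ℝ) (i j : Fin 4) :
    HasDerivAt (fun u => boostRot k m u i j) ((boostRotGen k m * boostRot k m s) i j) s := by
  have hk : HasDerivAt (fun u : ℝ => k * u) k s := by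
    simpa using (hasDerivAt_id s).const_mul k
  have hm : HasDerivAt (fun u : ℝ => m * u) m s := by
    simpa using (hasDerivAt_id s).const_mul m
  have h1 : HasDerivAt (fun u => Real.cosh (k * u)) (k * Real.sinh (k * s)) s := by
    simpa [mul_comm] using hk.cosh
  have h2 : HasDerivAt (fun u => Real.sinh (k * u)) (k * Real.cosh (k * s)) s := by
    simpa [mul_comm] using hk.sinh
  have h3 : HasDerivAt (fun u => Real.cos (m * u)) (-(m * Real.sin (m * s))) s := by
    simpa [mul_comm] using hm.cos
  have h4 : HasDerivAt (fun u => Real.sin (m * u)) (m * Real.cos (m * s)) s := by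
    simpa [mul_comm] using hm.sin
  fin_cases i <;> fin_cases j <;>
    simp [boostRot, boostRotGen, Matrix.mul_apply, Fin.sum_univ_four, h1, h2, h3, h4,
      hasDerivAt_const, h4.fun_neg]

theorem hasDerivAt_boostRotInt (k m s : ℝ) (β : Fin 4 → ℝ) (i : Fin 4) :
    HasDerivAt (fun u => boostRotInt k m u β i) ((boostRot k m s).mulVec β i) s := by
  have h1 := hasDerivAt_coshInt k s
  have h2 := hasDerivAt_sinhInt k s
  have h3 := hasDerivAt_cosInt m s
  have h4 := hasDerivAt_sinInt m s
  fin_cases i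
  · simpa [boostRot, boostRotInt, Matrix.mulVec, dotProduct, Fin.sum_univ_four] using
      (h1.mul_const (β 0)).fun_add (h2.mul_const (β 3))
  · simpa [boostRot, boostRotInt, Matrix.mulVec, dotProduct, Fin.sum_univ_four, sub_eq_add_neg]
      using (h3.mul_const (β 1)).fun_sub (h4.mul_const (β 2))
  · simpa [boostRot, boostRotInt, Matrix.mulVec, dotProduct, Fin.sum_univ_four] using
      (h4.mul_const (β 1)).fun_add (h3.mul_const (β 2))
  · simpa [boostRot, boostRotInt, Matrix.mulVec, dotProduct, Fin.sum_univ_four] using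
      (h2.mul_const (β 0)).fun_add (h1.mul_const (β 3))

/-- This is `exp(sA) = 1 + A ∫₀ˢ exp(uA) du`, needed for the translation part of the flow to satisfy
its differential equation. -/
theorem boostRot_mulVec_eq (k m s : ℝ) (β : Fin 4 → ℝ) :
    (boostRot k m s).mulVec β = β + (boostRotGen k m).mulVec (boostRotInt k m s β) := by
  have h1 := mul_coshInt k s
  have h2 := mul_sinhInt k s
  have h3 := mul_cosInt m s
  have h4 := mul_sinInt m s
  ext i
  fin_cases i <;>
    simp [boostRot, boostRotGen, boostRotInt, Matrix.mulVec, dotProduct, Fin.sum_univ_four]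
  · linear_combination -β 3 * h1 - β 0 * h2
  · linear_combination β 2 * h3 + β 1 * h4
  · linear_combination -β 1 * h3 + β 2 * h4
  · linear_combination -β 0 * h1 - β 3 * h2

/-- The affine flow `y ↦ X + exp (s A) (y - X) + i ∫₀ˢ exp (u A) β du`. -/
def affineFlow (k m : ℝ) (β X : Fin 4 → ℝ) (s : ℝ) :
    Matrix (Fin 4 ⊕ Unit) (Fin 4 ⊕ Unit) ℂ :=
  Matrix.fromBlocks ((boostRot k m s).map ofReal)
    (Matrix.of fun μ _ => ((X μ - (boostRot k m s).mulVec X μ : ℝ) : ℂ) +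
      I * (boostRotInt k m s β μ : ℝ)) 0 1

/-- The affine vector field `y ↦ A (y - X) + i β`. -/
def affineGen (k m : ℝ) (β X : Fin 4 → ℝ) : Matrix (Fin 4 ⊕ Unit) (Fin 4 ⊕ Unit) ℂ :=
  Matrix.fromBlocks ((boostRotGen k m).map ofReal)
    (Matrix.of fun μ _ => ((-(boostRotGen k m).mulVec X μ : ℝ) : ℂ) + I * (β μ : ℝ)) 0 0

theorem hasDerivAt_boostRot_mulVec (k m s : ℝ) (X : Fin 4 → ℝ) (i : Fin 4) :
    HasDerivAt (fun u => (boostRot k m u).mulVec X i)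
      ((boostRotGen k m).mulVec ((boostRot k m s).mulVec X) i) s := by
  rw [Matrix.mulVec_mulVec]
  simp only [Matrix.mulVec, dotProduct]
  exact HasDerivAt.fun_sum fun j _ => (hasDerivAt_boostRot k m s i j).mul_const (X j)

theorem affineFlow_eq_exp (k m : ℝ) (β X : Fin 4 → ℝ) (s : ℝ) :
    affineFlow k m β X s = NormedSpace.exp (s • affineGen k m β X) := by
  refine eq_exp_smul_of_hasDerivAt _ _ (fun s i j => ?_) ?_ s
  · have hprod : affineGen k m β X * affineFlow k m β X s =
        Matrix.fromBlocks ((boostRotGen k m * boostRot k m s).map ofReal)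
          (Matrix.of fun μ _ =>
            ((-(boostRotGen k m).mulVec ((boostRot k m s).mulVec X) μ : ℝ) : ℂ) +
              I * ((boostRot k m s).mulVec β μ : ℝ)) 0 0 := by
      rw [affineGen, affineFlow, Matrix.fromBlocks_multiply]
      congr 1
      · ext i j
        simp [Matrix.mul_apply]
      · ext μ _
        rw [boostRot_mulVec_eq k m s β]
        simp only [Matrix.add_apply, Matrix.mul_apply, Matrix.of_apply, Matrix.map_apply,
          Matrix.mulVec, dotProduct, Pi.add_apply]
        simp only [Finset.univ_unique, Finset.sum_singleton, Matrix.one_apply_eq, mul_one]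
        push_cast
        simp only [mul_add, mul_sub, Finset.sum_add_distrib, Finset.sum_sub_distrib,
          Finset.mul_sum]
        have : ∀ j, (boostRotGen k m μ j : ℂ) * (I * (boostRotInt k m s β j : ℂ)) =
            I * ((boostRotGen k m μ j : ℂ) * (boostRotInt k m s β j : ℂ)) := fun j => by ring
        simp only [this]
        ring
      · simp
      · simp
    rw [hprod]
    rcases i with i | i <;> rcases j with j | j
    · exact (hasDerivAt_boostRot k m s i j).ofReal_comp
    · have h1 := ((hasDerivAt_boostRot_mulVec k m s X i).const_sub (X i)).ofReal_comp
      have h2 := ((hasDerivAt_boostRotInt k m s β i).ofReal_comp).const_mul I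
      exact h1.add h2
    · exact hasDerivAt_const _ _
    · exact hasDerivAt_const _ _
  · have h1 : boostRot k m 0 = 1 := by
      ext i j
      fin_cases i <;> fin_cases j <;> simp [boostRot]
    have h2 : boostRotInt k m 0 β = 0 := by
      ext i
      fin_cases i <;> simp [boostRotInt, coshInt, sinhInt, cosInt, sinInt]
    rw [affineFlow, h1, h2, ← Matrix.fromBlocks_one]
    congr 1
    · ext i j
      simp [Matrix.one_apply, apply_ite]
    · ext i j
      simp

theorem affineFlow_nat_succ (k m : ℝ) (β X : Fin 4 → ℝ) (n : ℕ) :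
    affineFlow k m β X (n + 1 : ℕ) = affineFlow k m β X 1 * affineFlow k m β X n := by
  simp only [affineFlow_eq_exp, Nat.cast_smul_eq_nsmul, one_smul, Matrix.exp_nsmul, pow_succ']

/-- The factor `i` of the generator meets the `-i` of the vorticity, leaving a real Lorentz
generator `A`. Fixing the four-temperature at `X` turns the inhomogeneous part into `iβ - AX`, so
the real motion has `X` as a fixed point. -/
theorem densityGenerator_eq (T₀ a ω ξ : ℝ) (β X : Fin 4 → ℝ) :
    densityGenerator (shiftedB β (vorticity T₀ a ω) X ξ) (imagVorticity (vorticity T₀ a ω) ξ) =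
      affineGen (ξ * (a / T₀)) (ξ * (ω / T₀)) β X := by
  have h : I • (metric ℂ * imagVorticity (vorticity T₀ a ω) ξ) =
      (boostRotGen (ξ * (a / T₀)) (ξ * (ω / T₀))).map ofReal := by
    ext i j
    rw [metric, Matrix.smul_apply, Matrix.diagonal_mul]
    fin_cases i <;> fin_cases j <;> simp [imagVorticity, vorticity, boostRotGen] <;>
      ring_nf <;> simp [I_sq]
  rw [densityGenerator, affineGen, h]
  congr 1
  ext μ _
  have h2 : I * ((metric ℂ * imagVorticity (vorticity T₀ a ω) ξ).mulVec (toC X)) μ =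
      (((boostRotGen (ξ * (a / T₀)) (ξ * (ω / T₀))).mulVec X μ : ℝ) : ℂ) := by
    rw [← smul_eq_mul, ← Pi.smul_apply, ← Matrix.smul_mulVec, h]
    simp [Matrix.mulVec, dotProduct, toC]
  simp only [Matrix.of_apply, shiftedB, Pi.sub_apply, mul_sub, h2]
  simp only [toC]
  push_cast
  ring

theorem densityElement_eq (T₀ a ω ξ : ℝ) (β X : Fin 4 → ℝ) :
    densityElement (shiftedB β (vorticity T₀ a ω) X ξ) (imagVorticity (vorticity T₀ a ω) ξ) =
      affineFlow (ξ * (a / T₀)) (ξ * (ω / T₀)) β X 1 := by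
  rw [densityElement, densityGenerator_eq, affineFlow_eq_exp, one_smul]

/-! ### Iterates of the one-particle transformation -/

theorem onShell_sq (p : Momentum) :
    onShell p 0 ^ 2 = onShell p 1 ^ 2 + onShell p 2 ^ 2 + onShell p 3 ^ 2 := by
  have h := EuclideanSpace.real_norm_sq_eq p
  rw [Fin.sum_univ_three] at h
  exact h

theorem abs_onShell_three_le (p : Momentum) : |onShell p 3| ≤ onShell p 0 := by
  refine abs_le_of_sq_le_sq ?_ (norm_nonneg p)
  rw [onShell_sq]
  nlinarith [sq_nonneg (onShell p 1), sq_nonneg (onShell p 2)]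

theorem abs_sinh_le_cosh (x : ℝ) : |Real.sinh x| ≤ Real.cosh x := by
  refine abs_le_of_sq_le_sq ?_ (Real.cosh_pos x).le
  rw [Real.cosh_sq]
  linarith

/-- The action of `boostRot` on massless momenta. -/
def momentumFlow (k m s : ℝ) (p : Momentum) : Momentum :=
  WithLp.toLp 2 fun i : Fin 3 => (boostRot k m s).mulVec (onShell p) i.succ

/-- The boost-rotation preserves the light cone and keeps the time component nonnegative, so that
component is the norm of the new momentum. -/
theorem onShell_momentumFlow (k m s : ℝ) (p : Momentum) :
    onShell (momentumFlow k m s p) = (boostRot k m s).mulVec (onShell p) := by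
  have hnn : 0 ≤ (boostRot k m s).mulVec (onShell p) 0 := by
    have h1 := abs_onShell_three_le p
    have h2 := abs_sinh_le_cosh (k * s)
    have h3 : |Real.sinh (k * s) * onShell p 3| ≤ Real.cosh (k * s) * onShell p 0 := by
      rw [abs_mul]
      exact mul_le_mul h2 h1 (abs_nonneg _) (Real.cosh_pos _).le
    have h4 := neg_le_of_abs_le h3
    simp [boostRot, Matrix.mulVec, dotProduct, Fin.sum_univ_four]
    linarith
  ext i
  refine Fin.cases ?_ (fun j => rfl) i
  have h : ‖momentumFlow k m s p‖ ^ 2 = (boostRot k m s).mulVec (onShell p) 0 ^ 2 := by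
    rw [EuclideanSpace.real_norm_sq_eq, Fin.sum_univ_three]
    have h5 := onShell_sq p
    simp [momentumFlow, boostRot, Matrix.mulVec, dotProduct, Fin.sum_univ_four]
    have h6 := Real.cosh_sq (k * s)
    have h7 := Real.sin_sq_add_cos_sq (m * s)
    linear_combination (onShell p 1 ^ 2 + onShell p 2 ^ 2) * h7 +
      (onShell p 3 ^ 2 - onShell p 0 ^ 2) * h6 - h5
  exact (pow_left_inj₀ (norm_nonneg _) hnn two_ne_zero).1 h

theorem toC_mulVec (L : Matrix (Fin 4) (Fin 4) ℝ) (v : Fin 4 → ℝ) :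
    toC (L.mulVec v) = (L.map ofReal).mulVec (toC v) := by
  ext i
  simp [toC, Matrix.mulVec, dotProduct]

theorem lorentzAct_boostRot (k m s : ℝ) (p : Momentum) :
    lorentzAct ((boostRot k m s).map ofReal) p = momentumFlow k m s p := by
  ext i
  simp only [lorentzAct, momentumFlow, ← toC_mulVec]
  rfl

theorem mdot_boostRot (k m s : ℝ) (u v : Fin 4 → ℂ) :
    mdot (((boostRot k m s).map ofReal).mulVec u) (((boostRot k m s).map ofReal).mulVec v) =
      mdot u v := by
  have h1 := Complex.cosh_sq (k * s)
  have h2 := Complex.sin_sq_add_cos_sq (m * s)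
  simp [mdot, boostRot, Matrix.mulVec, dotProduct, Fin.sum_univ_four]
  linear_combination (u 0 * v 0 - u 3 * v 3) * h1 - (u 1 * v 1 + u 2 * v 2) * h2

/-- The translation part of the affine flow. -/
def flowShift (k m : ℝ) (β X : Fin 4 → ℝ) (s : ℝ) : Fin 4 → ℂ :=
  fun μ => ((X μ - (boostRot k m s).mulVec X μ : ℝ) : ℂ) + I * (boostRotInt k m s β μ : ℝ)

theorem boostRot_nat_succ (k m : ℝ) (n : ℕ) :
    boostRot k m (n + 1 : ℕ) = boostRot k m 1 * boostRot k m n := by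
  have h1 := Real.cosh_add k (k * n)
  have h2 := Real.sinh_add k (k * n)
  have h3 := Real.cos_add m (m * n)
  have h4 := Real.sin_add m (m * n)
  have e : ∀ x : ℝ, x * ((n + 1 : ℕ) : ℝ) = x + x * n := fun x => by push_cast; ring
  ext i j
  fin_cases i <;> fin_cases j <;>
    simp [boostRot, Matrix.mul_apply, Fin.sum_univ_four, e, h1, h2, h3, h4, -Nat.cast_add] <;> ring

theorem flowShift_nat_succ (k m : ℝ) (β X : Fin 4 → ℝ) (n : ℕ) :
    flowShift k m β X (n + 1 : ℕ) =
      ((boostRot k m 1).map ofReal).mulVec (flowShift k m β X n) + flowShift k m β X 1 := by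
  have h := congrArg Matrix.toBlocks₁₂ (affineFlow_nat_succ k m β X n)
  simp only [affineFlow, Matrix.fromBlocks_multiply, Matrix.toBlocks_fromBlocks₁₂] at h
  ext μ
  have h2 := congrFun (congrFun h μ) ()
  simp only [Matrix.add_apply, Matrix.mul_apply, Matrix.of_apply, Finset.univ_unique,
    Finset.sum_singleton, Matrix.one_apply_eq, mul_one] at h2
  exact h2

section

variable {T₀ a ω ξ : ℝ} {β X : Fin 4 → ℝ}

theorem oneParticle_eq (g : Momentum → ℂ) (p : Momentum) :
    oneParticle (shiftedB β (vorticity T₀ a ω) X ξ) (imagVorticity (vorticity T₀ a ω) ξ) g p =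
      Complex.exp (I * mdot (flowShift (ξ * (a / T₀)) (ξ * (ω / T₀)) β X 1)
        (toC (onShell (momentumFlow (ξ * (a / T₀)) (ξ * (ω / T₀)) 1 p)))) *
        g (momentumFlow (ξ * (a / T₀)) (ξ * (ω / T₀)) 1 p) := by
  have h1 : lorentzPart (shiftedB β (vorticity T₀ a ω) X ξ)
      (imagVorticity (vorticity T₀ a ω) ξ) =
      (boostRot (ξ * (a / T₀)) (ξ * (ω / T₀)) 1).map ofReal := by
    rw [lorentzPart, densityElement_eq, affineFlow, Matrix.toBlocks_fromBlocks₁₁]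
  have h2 : translationPart (shiftedB β (vorticity T₀ a ω) X ξ)
      (imagVorticity (vorticity T₀ a ω) ξ) =
      flowShift (ξ * (a / T₀)) (ξ * (ω / T₀)) β X 1 := by
    ext μ
    rw [translationPart, densityElement_eq, affineFlow, Matrix.toBlocks_fromBlocks₁₂]
    rfl
  rw [oneParticle, h1, h2, lorentzAct_boostRot]

theorem momentumFlow_nat_succ (k m : ℝ) (n : ℕ) (p : Momentum) :
    momentumFlow k m 1 (momentumFlow k m n p) = momentumFlow k m (n + 1 : ℕ) p := by
  ext i
  rw [momentumFlow, onShell_momentumFlow, Matrix.mulVec_mulVec, ← boostRot_nat_succ]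
  rfl

/-- Iterating the action of `ρ` is acting with `ρⁿ`. The phases compose by the group law of the
affine flow, with Lorentz invariance carrying the earlier shift through the last transformation. -/
theorem iterate_oneParticle_eq (n : ℕ) (g : Momentum → ℂ) (p : Momentum) :
    (oneParticle (shiftedB β (vorticity T₀ a ω) X ξ)
      (imagVorticity (vorticity T₀ a ω) ξ))^[n] g p =
      Complex.exp (I * mdot (flowShift (ξ * (a / T₀)) (ξ * (ω / T₀)) β X n)
        (toC (onShell (momentumFlow (ξ * (a / T₀)) (ξ * (ω / T₀)) n p)))) *
        g (momentumFlow (ξ * (a / T₀)) (ξ * (ω / T₀)) n p) := by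
  induction n generalizing g with
  | zero =>
    have h1 : ∀ k m : ℝ, momentumFlow k m 0 p = p := by
      intro k m
      ext i
      fin_cases i <;> simp [momentumFlow, boostRot, Matrix.mulVec, dotProduct, Fin.sum_univ_four,
        onShell]
    have h2 : ∀ k m : ℝ, flowShift k m β X 0 = 0 := by
      intro k m
      ext i
      fin_cases i <;> simp [flowShift, boostRotInt, boostRot, Matrix.mulVec, dotProduct,
        Fin.sum_univ_four, coshInt, sinhInt, cosInt, sinInt]
    simp [h1, h2, mdot]
  | succ n ih =>
    rw [Function.iterate_succ_apply, ih, oneParticle_eq, ← mul_assoc, ← Complex.exp_add,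
      momentumFlow_nat_succ, ← mul_add]
    congr 3
    rw [flowShift_nat_succ, onShell_momentumFlow, onShell_momentumFlow, boostRot_nat_succ]
    rw [← Matrix.mulVec_mulVec, toC_mulVec (boostRot _ _ 1)]
    have hadd : ∀ u v w : Fin 4 → ℂ, mdot (u + v) w = mdot u w + mdot v w := by
      intro u v w
      simp only [mdot, Pi.add_apply]
      ring
    rw [hadd, mdot_boostRot]

/-- Lorentz invariance moves `exp(-sA)` onto the integral, which reverses the flow and gives the
accumulated four-temperature. -/
theorem mdot_boostRotInt (k m s : ℝ) (β q : Fin 4 → ℝ) :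
    mdot (boostRotInt k m s β) ((boostRot k m s).mulVec q) = mdot (accTemp k m s β) q := by
  have h1 := cosh_mul_coshInt_sub k s
  have h2 := cosh_mul_sinhInt_sub k s
  have h3 := cos_mul_cosInt_add m s
  have h4 := sin_mul_cosInt_sub m s
  simp [mdot, boostRot, boostRotInt, accTemp, Matrix.mulVec, dotProduct, Fin.sum_univ_four]
  linear_combination (β 0 * q 0 - β 3 * q 3) * h1 + (β 3 * q 0 - β 0 * q 3) * h2 -
    (β 1 * q 1 + β 2 * q 2) * h3 + (β 1 * q 2 - β 2 * q 1) * h4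

/-- The phase is `p·X + (X - LX)·Lp - Lp·X`, where `LX·Lp = X·p`, so it vanishes. Only the real
exponential from the imaginary translation survives. -/
theorem exp_mul_iterate_planeWave (n : ℕ) (p : Momentum) :
    Complex.exp (I * mdot (toC (onShell p)) (toC X)) *
      (oneParticle (shiftedB β (vorticity T₀ a ω) X ξ)
        (imagVorticity (vorticity T₀ a ω) ξ))^[n] (planeWave X) p =
      (Real.exp (-mdot (accTemp (ξ * (a / T₀)) (ξ * (ω / T₀)) n β) (onShell p)) : ℝ) := by
  rw [iterate_oneParticle_eq, planeWave, ← Complex.exp_add, ← Complex.exp_add, ofReal_exp,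
    ← mdot_boostRotInt, onShell_momentumFlow]
  congr 1
  set L := boostRot (ξ * (a / T₀)) (ξ * (ω / T₀)) n with hL
  have h1 := mdot_boostRot (ξ * (a / T₀)) (ξ * (ω / T₀)) n (toC X) (toC (onShell p))
  rw [← hL, ← toC_mulVec, ← toC_mulVec] at h1
  simp only [mdot, toC, flowShift, ← hL] at h1 ⊢
  push_cast
  linear_combination (-I) * h1 + (boostRotInt (ξ * (a / T₀)) (ξ * (ω / T₀)) n β 0 *
    (L.mulVec (onShell p) 0) - boostRotInt (ξ * (a / T₀)) (ξ * (ω / T₀)) n β 1 *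
    (L.mulVec (onShell p) 1) - boostRotInt (ξ * (a / T₀)) (ξ * (ω / T₀)) n β 2 *
    (L.mulVec (onShell p) 2) - boostRotInt (ξ * (a / T₀)) (ξ * (ω / T₀)) n β 3 *
    (L.mulVec (onShell p) 3) : ℂ) * I_sq

end

/-! ### The mean value at imaginary thermal vorticity as a series -/

theorem mdot_accTemp (k m s : ℝ) (β : Fin 4 → ℝ) :
    mdot (accTemp k m s β) (accTemp k m s β) =
      (β 0 ^ 2 - β 3 ^ 2) * (coshInt k s ^ 2 - sinhInt k s ^ 2) -
        (β 1 ^ 2 + β 2 ^ 2) * (cosInt m s ^ 2 + sinInt m s ^ 2) := by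
  simp [mdot, accTemp]
  ring

/-- Along the flow, boosts can only enlarge the time-like part and rotations can only shrink the
transverse part, relative to straight accumulation `sβ`. -/
theorem le_mdot_accTemp (k m s : ℝ) {β : Fin 4 → ℝ} (hβ : 0 < mdot β β) :
    mdot β β * s ^ 2 ≤ mdot (accTemp k m s β) (accTemp k m s β) := by
  rw [mdot_accTemp]
  rw [mdot] at hβ ⊢
  have h1 := sq_le_coshInt_sq_sub k s
  have h2 := cosInt_sq_add_le m s
  have h3 : 0 ≤ β 0 ^ 2 - β 3 ^ 2 := by nlinarith [sq_nonneg (β 1), sq_nonneg (β 2)]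
  have h4 : 0 ≤ β 1 ^ 2 + β 2 ^ 2 := by positivity
  nlinarith [mul_le_mul_of_nonneg_left h1 h3, mul_le_mul_of_nonneg_left h2 h4]

/-- The space part of a four-vector. -/
def spacePart (v : Fin 4 → ℝ) : Momentum := WithLp.toLp 2 fun i => v i.succ

theorem mdot_onShell (v : Fin 4 → ℝ) (p : Momentum) :
    mdot v (onShell p) = v 0 * ‖p‖ - inner ℝ (spacePart v) p := by
  rw [PiLp.inner_apply, Fin.sum_univ_three]
  simp [mdot, onShell, spacePart]
  ring

theorem mdot_self_eq (v : Fin 4 → ℝ) : mdot v v = v 0 ^ 2 - ‖spacePart v‖ ^ 2 := by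
  rw [EuclideanSpace.real_norm_sq_eq, Fin.sum_univ_three]
  simp [mdot, spacePart]
  ring

theorem norm_spacePart_lt {v : Fin 4 → ℝ} (h0 : 0 < v 0) (hv : 0 < mdot v v) :
    ‖spacePart v‖ < v 0 := by
  rw [mdot_self_eq] at hv
  exact lt_of_pow_lt_pow_left₀ 2 h0.le (by linarith)

theorem accTemp_zero_pos (k m : ℝ) {s : ℝ} (hs : 0 < s) {β : Fin 4 → ℝ} (h0 : 0 < β 0)
    (hβ : 0 < mdot β β) : 0 < accTemp k m s β 0 := by
  have h1 : |β 3| < β 0 := by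
    refine abs_lt_of_sq_lt_sq ?_ h0.le
    rw [mdot] at hβ
    nlinarith [sq_nonneg (β 1), sq_nonneg (β 2)]
  have h2 := coshInt_pos k hs
  have h3 : |sinhInt k s| ≤ coshInt k s := by
    refine abs_le_of_sq_le_sq ?_ h2.le
    nlinarith [sq_le_coshInt_sq_sub k s]
  have h4 : sinhInt k s * β 3 ≤ coshInt k s * |β 3| := by
    refine (le_abs_self _).trans ?_
    rw [abs_mul]
    gcongr
  have h5 : coshInt k s * |β 3| < coshInt k s * β 0 := by gcongr
  change 0 < coshInt k s * β 0 - sinhInt k s * β 3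
  linarith

theorem integrable_exp_neg_mdot {v : Fin 4 → ℝ} (h0 : 0 < v 0) (hv : 0 < mdot v v) :
    Integrable fun p : Momentum => ‖p‖⁻¹ * Real.exp (-mdot v (onShell p)) := by
  simp only [mdot_onShell]
  exact integrable_boltzmann (norm_spacePart_lt h0 hv)

theorem integral_exp_neg_mdot {v : Fin 4 → ℝ} (h0 : 0 < v 0) (hv : 0 < mdot v v) :
    ∫ p : Momentum, ‖p‖⁻¹ * Real.exp (-mdot v (onShell p)) = 4 * Real.pi / mdot v v := by
  simp only [mdot_onShell]
  rw [integral_boltzmann (norm_spacePart_lt h0 hv), mdot_self_eq]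

theorem ae_summable_and_integrable_tsum {α : Type*} [MeasurableSpace α] {μ : Measure α}
    {F : ℕ → α → ℝ} (hF : ∀ n, Integrable (F n) μ) (h0 : ∀ n x, 0 ≤ F n x)
    (hs : Summable fun n => ∫ x, F n x ∂μ) :
    (∀ᵐ x ∂μ, Summable fun n => F n x) ∧ Integrable (fun x => ∑' n, F n x) μ := by
  have hfin : ∫⁻ x, ∑' n, ENNReal.ofReal (F n x) ∂μ ≠ ⊤ := by
    rw [lintegral_tsum fun n => (hF n).aemeasurable.ennreal_ofReal]
    have : ∀ n, ∫⁻ x, ENNReal.ofReal (F n x) ∂μ = ENNReal.ofReal (∫ x, F n x ∂μ) := fun n =>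
      (ofReal_integral_eq_lintegral_ofReal (hF n) (ae_of_all _ (h0 n))).symm
    simp only [this]
    exact hs.tsum_ofReal_ne_top
  have hm : AEMeasurable (fun x => ∑' n, ENNReal.ofReal (F n x)) μ :=
    AEMeasurable.tsum fun n => (hF n).aemeasurable.ennreal_ofReal
  have hae : ∀ᵐ x ∂μ, Summable fun n => F n x := by
    filter_upwards [ae_lt_top' hm hfin] with x hx
    have := ENNReal.summable_toReal hx.ne
    simpa only [ENNReal.toReal_ofReal (h0 _ x)] using this
  refine ⟨hae, ?_⟩
  refine (integrable_toReal_of_lintegral_ne_top hm hfin).congr ?_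
  filter_upwards [hae] with x hx
  rw [← ENNReal.ofReal_tsum_of_nonneg (fun n => h0 n x) hx,
    ENNReal.toReal_ofReal (tsum_nonneg fun n => h0 n x)]

section

variable {T₀ a ω : ℝ} {β X : Fin 4 → ℝ}

theorem mdot_accTemp_nat_pos (k m : ℝ) (n : ℕ) (hβ : 0 < mdot β β) :
    0 < mdot (accTemp k m (n + 1 : ℕ) β) (accTemp k m (n + 1 : ℕ) β) := by
  refine lt_of_lt_of_le ?_ (le_mdot_accTemp k m _ hβ)
  positivity

theorem summable_inv_mdot_accTemp (k m : ℝ) (hβ : 0 < mdot β β) :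
    Summable fun n : ℕ =>
      4 * Real.pi / mdot (accTemp k m (n + 1 : ℕ) β) (accTemp k m (n + 1 : ℕ) β) := by
  have h2 : Summable fun n : ℕ => (1 : ℝ) / ((n + 1 : ℕ) : ℝ) ^ 2 :=
    (summable_nat_add_iff 1).2 (Real.summable_one_div_nat_pow.2 one_lt_two)
  refine Summable.of_nonneg_of_le (fun n => ?_) (fun n => ?_) (h2.mul_left (4 * Real.pi / mdot β β))
  · have := mdot_accTemp_nat_pos k m n hβ
    positivity
  · rw [div_mul_div_comm, mul_one]
    gcongr
    exact le_mdot_accTemp k m _ hβ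

/-- All terms are nonnegative and their integrals are dominated by `4π/(β² n²)`, with `n` the
iteration number. This justifies exchanging sum and integral. -/
theorem occupation_series (k m : ℝ) (h0 : 0 < β 0) (hβ : 0 < mdot β β) :
    (∀ᵐ p : Momentum, Summable fun n : ℕ =>
      ‖p‖⁻¹ * Real.exp (-mdot (accTemp k m (n + 1 : ℕ) β) (onShell p))) ∧
    Integrable (fun p : Momentum => ∑' n : ℕ,
      ‖p‖⁻¹ * Real.exp (-mdot (accTemp k m (n + 1 : ℕ) β) (onShell p))) ∧
    ∫ p : Momentum, ∑' n : ℕ,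
      ‖p‖⁻¹ * Real.exp (-mdot (accTemp k m (n + 1 : ℕ) β) (onShell p)) =
      ∑' n : ℕ, 4 * Real.pi / mdot (accTemp k m (n + 1 : ℕ) β) (accTemp k m (n + 1 : ℕ) β) := by
  have hpos : ∀ n : ℕ, 0 < accTemp k m (n + 1 : ℕ) β 0 := fun n =>
    accTemp_zero_pos k m (by positivity) h0 hβ
  have hI := fun n : ℕ => integrable_exp_neg_mdot (hpos n) (mdot_accTemp_nat_pos k m n hβ)
  have hV := fun n : ℕ => integral_exp_neg_mdot (hpos n) (mdot_accTemp_nat_pos k m n hβ)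
  have hS := summable_inv_mdot_accTemp k m hβ
  have h1 := ae_summable_and_integrable_tsum hI (fun n p => by positivity)
    (by simpa only [hV] using hS)
  refine ⟨h1.1, h1.2, ?_⟩
  have h2 := hasSum_integral_of_summable_integral_norm hI (by
    have : ∀ (n : ℕ) (p : Momentum),
        ‖‖p‖⁻¹ * Real.exp (-mdot (accTemp k m (n + 1 : ℕ) β) (onShell p))‖ =
        ‖p‖⁻¹ * Real.exp (-mdot (accTemp k m (n + 1 : ℕ) β) (onShell p)) := fun n p =>
      Real.norm_of_nonneg (by positivity)
    simpa only [this, hV] using hS)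
  rw [← h2.tsum_eq]
  simp only [hV]

theorem inv_norm_mul_phaseSpaceDensity (ξ : ℝ) (p : Momentum) :
    (‖p‖ : ℂ)⁻¹ * phaseSpaceDensity (shiftedB β (vorticity T₀ a ω) X ξ)
      (imagVorticity (vorticity T₀ a ω) ξ) X p =
      ((((2 * Real.pi) ^ 3)⁻¹ * ∑' n : ℕ, ‖p‖⁻¹ * Real.exp (-mdot
        (accTemp (ξ * (a / T₀)) (ξ * (ω / T₀)) (n + 1 : ℕ) β) (onShell p)) : ℝ) : ℂ) := by
  rw [phaseSpaceDensity, occupation, ← tsum_mul_left]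
  simp only [exp_mul_iterate_planeWave]
  rw [tsum_mul_left, ← ofReal_tsum]
  push_cast
  ring

theorem ae_summable_iterate (ξ : ℝ) (h0 : 0 < β 0) (hβ : 0 < mdot β β) :
    ∀ᵐ p : Momentum, Summable fun n : ℕ =>
      ((oneParticle (shiftedB β (vorticity T₀ a ω) X ξ)
        (imagVorticity (vorticity T₀ a ω) ξ))^[n + 1] (planeWave X)) p := by
  -- At `p = 0` the weight `‖p‖⁻¹` is `0` by convention, so the weighted series carries no
  -- information there; the point is negligible.
  have hne : ∀ᵐ p : Momentum, p ≠ 0 := Measure.ae_ne volume 0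
  filter_upwards [(occupation_series (ξ * (a / T₀)) (ξ * (ω / T₀)) h0 hβ).1, hne] with p hp hp0
  have h1 := (summable_mul_left_iff (inv_ne_zero (norm_ne_zero_iff.2 hp0))).1 hp
  have h2 := Complex.hasSum_ofReal.2 h1.hasSum
  have h3 := h2.summable
  simp only [← exp_mul_iterate_planeWave (T₀ := T₀) (a := a) (ω := ω) (ξ := ξ) (X := X)] at h3
  exact (summable_mul_left_iff (Complex.exp_ne_zero _)).1 h3

theorem integrable_phaseSpaceDensity (ξ : ℝ) (h0 : 0 < β 0) (hβ : 0 < mdot β β) :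
    Integrable fun p : Momentum => (‖p‖ : ℂ)⁻¹ * phaseSpaceDensity
      (shiftedB β (vorticity T₀ a ω) X ξ) (imagVorticity (vorticity T₀ a ω) ξ) X p := by
  simp only [inv_norm_mul_phaseSpaceDensity]
  exact ((occupation_series (ξ * (a / T₀)) (ξ * (ω / T₀)) h0 hβ).2.1.const_mul _).ofReal

theorem psiSqImag_eq_tsum (ξ : ℝ) (h0 : 0 < β 0) (hβ : 0 < mdot β β) :
    psiSqImag (shiftedB β (vorticity T₀ a ω) X ξ) (imagVorticity (vorticity T₀ a ω) ξ) X =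
      ((1 / (2 * Real.pi ^ 2) * ∑' n : ℕ,
        (mdot (accTemp (ξ * (a / T₀)) (ξ * (ω / T₀)) (n + 1 : ℕ) β)
          (accTemp (ξ * (a / T₀)) (ξ * (ω / T₀)) (n + 1 : ℕ) β))⁻¹ : ℝ) : ℂ) := by
  rw [psiSqImag]
  simp only [inv_norm_mul_phaseSpaceDensity]
  rw [integral_complex_ofReal, integral_const_mul,
    (occupation_series (ξ * (a / T₀)) (ξ * (ω / T₀)) h0 hβ).2.2]
  simp only [div_eq_mul_inv (4 * Real.pi)]
  rw [tsum_mul_left, ← mul_assoc]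
  congr 2
  have := Real.pi_ne_zero
  field_simp
  ring

/-- Rates `ξa`, `ξω` over time `s` amount to rates `a`, `ω` over time `sξ`, up to the scale `ξ²`.
This turns the thermal series into a sampling of one function with step `ξ`. The auxiliary `r`
avoids dividing by `ω²`. -/
theorem sq_mul_mdot_accTemp (a ω ξ s : ℝ) {r : ℝ} (hr : r * ω ^ 2 = β 1 ^ 2 + β 2 ^ 2) :
    ((ξ ^ 2 * mdot (accTemp (ξ * a) (ξ * ω) s β) (accTemp (ξ * a) (ξ * ω) s β) : ℝ) : ℂ) =
      distSq (β 0 ^ 2 - β 3 ^ 2) r a ω ((s * ξ : ℝ) : ℂ) := by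
  have h1 := coshInt_sq_sub_sinhInt_sq (ξ * a) s
  have h2 := cosInt_sq_add_sinInt_sq (ξ * ω) s
  have h2' := congrArg (fun x : ℝ => (x : ℂ)) h2
  have h3 := congrArg (fun x : ℝ => (x : ℂ)) hr
  rw [distSq_eq, mdot_accTemp]
  have e1 : ((ξ * a : ℝ) : ℂ) * s = a * ((s * ξ : ℝ) : ℂ) := by push_cast; ring
  have e2 : ((ξ * ω * s : ℝ) : ℂ) = ω * ((s * ξ : ℝ) : ℂ) := by push_cast; ring
  rw [e1] at h1
  simp only [ofReal_mul, ofReal_sub, ofReal_one, ofReal_cos, ofReal_ofNat] at h2'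
  rw [← ofReal_mul ξ ω, ← ofReal_mul (ξ * ω) s, e2] at h2'
  generalize coshRem (a * ((s * ξ : ℝ) : ℂ)) = M at *
  generalize cos (ω * ((s * ξ : ℝ) : ℂ)) = c at *
  push_cast at h1 h2' h3 ⊢
  linear_combination (ξ : ℂ) ^ 2 * ((β 0 : ℂ) ^ 2 - β 3 ^ 2) * h1 - r * h2' +
    (ξ : ℂ) ^ 2 * ((cosInt (ξ * ω) s : ℂ) ^ 2 + (sinInt (ξ * ω) s : ℂ) ^ 2) * h3

end

/-! ### The physical mean value -/

theorem exists_psiSqImag_expansion {T₀ a ω r : ℝ} {β X : Fin 4 → ℝ} (hr : 0 ≤ r)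
    (hrω : r * (ω / T₀) ^ 2 = β 1 ^ 2 + β 2 ^ 2) (h0 : 0 < β 0) (hβ : 0 < mdot β β) :
    ∃ c : ℂ, ∀ N : ℕ, ∃ C : ℝ, ∀ ξ : ℝ, ξ ≠ 0 →
      ‖psiSqImag (shiftedB β (vorticity T₀ a ω) X ξ) (imagVorticity (vorticity T₀ a ω) ξ) X -
        ((1 / (12 * mdot β β) : ℝ) + c * |ξ| +
          (((β 0 ^ 2 - β 3 ^ 2) * (a / T₀) ^ 2 + r * (ω / T₀) ^ 4) /
            (48 * Real.pi ^ 2 * mdot β β ^ 2) : ℝ) * ξ ^ 2)‖ ≤ C * |ξ| ^ (N + 3) := by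
  have hκ : (β 0 ^ 2 - β 3 ^ 2) - r * (ω / T₀) ^ 2 = mdot β β := by
    rw [hrω, mdot]
    ring
  have hl : 0 ≤ β 0 ^ 2 - β 3 ^ 2 := by
    have : 0 ≤ r * (ω / T₀) ^ 2 := by positivity
    linarith
  obtain ⟨c, hc⟩ := exists_tsum_inv_distSq_expansion (a / T₀) hl hr (by rwa [hκ])
  refine ⟨(1 / (2 * Real.pi ^ 2) : ℝ) * c, fun N => ?_⟩
  obtain ⟨C, hC⟩ := hc N
  refine ⟨1 / (2 * Real.pi ^ 2) * C, fun ξ hξ => ?_⟩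
  have hterm : ∀ n : ℕ, (ξ : ℂ) ^ 2 * (distSq (β 0 ^ 2 - β 3 ^ 2) r (a / T₀) (ω / T₀)
      (((n + 1 : ℕ) * ξ : ℝ) : ℂ))⁻¹ =
      (((mdot (accTemp (ξ * (a / T₀)) (ξ * (ω / T₀)) (n + 1 : ℕ) β)
        (accTemp (ξ * (a / T₀)) (ξ * (ω / T₀)) (n + 1 : ℕ) β))⁻¹ : ℝ) : ℂ) := by
    intro n
    have hξ' : (ξ : ℂ) ^ 2 ≠ 0 := pow_ne_zero _ (by exact_mod_cast hξ)
    rw [← sq_mul_mdot_accTemp _ _ _ _ hrω, ofReal_mul, ofReal_pow, mul_inv, ← mul_assoc,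
      mul_inv_cancel₀ hξ', one_mul, ofReal_inv]
  have h1 := hC ξ hξ
  simp only [hterm, ← ofReal_tsum] at h1
  rw [psiSqImag_eq_tsum ξ h0 hβ]
  have hπ := Real.pi_ne_zero
  have e1 : 1 / (12 * mdot β β) = 1 / (2 * Real.pi ^ 2) * (Real.pi ^ 2 / (6 * mdot β β)) := by
    field_simp
    norm_num
  have e2 : ((β 0 ^ 2 - β 3 ^ 2) * (a / T₀) ^ 2 + r * (ω / T₀) ^ 4) /
      (48 * Real.pi ^ 2 * mdot β β ^ 2) = 1 / (2 * Real.pi ^ 2) *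
      (((β 0 ^ 2 - β 3 ^ 2) * (a / T₀) ^ 2 + r * (ω / T₀) ^ 4) / (24 * mdot β β ^ 2)) := by
    rw [div_mul_div_comm]
    congr 1 <;> ring
  rw [hκ] at h1
  rw [e1, e2]
  have h2 := mul_le_mul_of_nonneg_left h1 (show 0 ≤ 1 / (2 * Real.pi ^ 2) by positivity)
  have hn : ∀ w : ℂ, 1 / (2 * Real.pi ^ 2) * ‖w‖ = ‖((1 / (2 * Real.pi ^ 2) : ℝ) : ℂ) * w‖ := by
    intro w
    rw [norm_mul, norm_real, Real.norm_of_nonneg (by positivity)]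
  rw [← mul_assoc, hn] at h2
  refine le_trans (le_of_eq ?_) h2
  congr 1
  simp only [ofReal_mul]
  ring

/-! ### The vectors `α` and `w` in components -/

/-- `leviCivita` is a Vandermonde product. -/
theorem leviCivita_eq (μ ν ρ σ : Fin 4) : leviCivita μ ν ρ σ =
    (((ν : ℝ) - μ) * (ρ - μ) * (σ - μ) * (ρ - ν) * (σ - ν) * (σ - ρ)) / 12 := by
  have h1 : leviCivita μ ν ρ σ = ((Matrix.det (Matrix.of fun i j : Fin 4 =>
      if ![μ, ν, ρ, σ] i = j then (1 : ℤ) else 0) : ℤ) : ℝ) := by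
    rw [leviCivita, Int.cast_det]
    congr 1
    ext i j
    simp
  -- The factor 12 is the Vandermonde product of `0, 1, 2, 3`. Over the integers the identity is a
  -- finite check.
  have h2 : ∀ μ ν ρ σ : Fin 4, Matrix.det (Matrix.of fun i j : Fin 4 =>
      if ![μ, ν, ρ, σ] i = j then (1 : ℤ) else 0) * 12 =
      ((ν : ℤ) - μ) * (ρ - μ) * (σ - μ) * (ρ - ν) * (σ - ν) * (σ - ρ) := by
    intro μ ν ρ σ
    simp only [Matrix.det_succ_row_zero, Fin.sum_univ_succ]
    revert μ ν ρ σ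
    decide
  rw [h1, eq_div_iff (by norm_num)]
  exact_mod_cast h2 μ ν ρ σ

theorem alphaVec_vorticity (T₀ a ω : ℝ) (β : Fin 4 → ℝ) :
    alphaVec β (vorticity T₀ a ω) = (Real.sqrt (mdot β β))⁻¹ •
      ![a / T₀ * β 3, -(ω / T₀ * β 2), ω / T₀ * β 1, a / T₀ * β 0] := by
  ext i
  fin_cases i <;>
    simp [alphaVec, fourVel, metric, vorticity, Matrix.mulVec, dotProduct, Fin.sum_univ_four,
      Matrix.diagonal_mul] <;> ring

theorem wVec_vorticity (T₀ a ω : ℝ) (β : Fin 4 → ℝ) :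
    wVec β (vorticity T₀ a ω) = (Real.sqrt (mdot β β))⁻¹ •
      ![ω / T₀ * β 3, a / T₀ * β 2, -(a / T₀ * β 1), ω / T₀ * β 0] := by
  ext i
  fin_cases i <;>
    simp [wVec, fourVel, metric, vorticity, leviCivita_eq, Matrix.mulVec_diagonal,
      Fin.sum_univ_four] <;> ring

end ThermalField

end

theorem mainTheorem4 (T₀ a ω t x y z : ℝ) (hT : 0 < T₀) (hz : 0 < 1 + a * z)
    (hβ : 0 < (1 + a * z) ^ 2 - a ^ 2 * t ^ 2 - (x ^ 2 + y ^ 2) * ω ^ 2)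
    (X β α w : Fin 4 → ℝ) (hX : X = ![t, x, y, z])
    (hβX : β = ThermalField.fourTemp (ThermalField.bVec T₀) (ThermalField.vorticity T₀ a ω) X)
    (hα : α = ThermalField.alphaVec β (ThermalField.vorticity T₀ a ω))
    (hw : w = ThermalField.wVec β (ThermalField.vorticity T₀ a ω)) :
    -- the four-temperature and its invariants
    β = ![(1 + a * z) / T₀, -(ω * y) / T₀, ω * x / T₀, a * t / T₀] ∧
    ThermalField.mdot β β =
      1 / T₀ ^ 2 * ((1 + a * z) ^ 2 - a ^ 2 * t ^ 2 - (x ^ 2 + y ^ 2) * ω ^ 2) ∧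
    ThermalField.mdot α α =
      -((a ^ 2 * ((1 + a * z) ^ 2 - a ^ 2 * t ^ 2) + (x ^ 2 + y ^ 2) * ω ^ 4) /
        (ThermalField.mdot β β * T₀ ^ 4)) ∧
    ThermalField.mdot α w = -(a * ω / T₀ ^ 2) ∧
    -- at imaginary thermal vorticity the series and the momentum integral converge
    (∀ ξ : ℝ,
      (∀ᵐ p : ThermalField.Momentum, Summable fun n : ℕ =>
        ((ThermalField.oneParticle
            (ThermalField.shiftedB β (ThermalField.vorticity T₀ a ω) X ξ)
            (ThermalField.imagVorticity (ThermalField.vorticity T₀ a ω) ξ))^[n + 1]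
          (ThermalField.planeWave X)) p) ∧
      MeasureTheory.Integrable fun p : ThermalField.Momentum =>
        (‖p‖ : ℂ)⁻¹ * ThermalField.phaseSpaceDensity
          (ThermalField.shiftedB β (ThermalField.vorticity T₀ a ω) X ξ)
          (ThermalField.imagVorticity (ThermalField.vorticity T₀ a ω) ξ) X p) ∧
    -- the thermal expectation value exists, is unique, and is given by the explicit formula
    (∀ v : ℂ,
      ThermalField.IsThermalPsiSq (ThermalField.bVec T₀) (ThermalField.vorticity T₀ a ω) X v ↔
        v = ((T₀ ^ 2 / (12 * ((1 + a * z) ^ 2 - a ^ 2 * t ^ 2 - (x ^ 2 + y ^ 2) * ω ^ 2)) -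
          (a ^ 2 * ((1 + a * z) ^ 2 - a ^ 2 * t ^ 2) + (x ^ 2 + y ^ 2) * ω ^ 4) /
            (48 * Real.pi ^ 2 *
              ((1 + a * z) ^ 2 - a ^ 2 * t ^ 2 - (x ^ 2 + y ^ 2) * ω ^ 2) ^ 2) : ℝ) : ℂ)) ∧
    -- in invariant form
    (∀ v : ℂ,
      ThermalField.IsThermalPsiSq (ThermalField.bVec T₀) (ThermalField.vorticity T₀ a ω) X v ↔
        v = ((1 / (12 * ThermalField.mdot β β) +
          ThermalField.mdot α α / (48 * Real.pi ^ 2 * ThermalField.mdot β β) : ℝ) : ℂ)) := by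
  have hT0 : T₀ ≠ 0 := hT.ne'
  have hβ4 : β = ![(1 + a * z) / T₀, -(ω * y) / T₀, ω * x / T₀, a * t / T₀] := by
    rw [hβX, hX]
    ext i
    fin_cases i <;>
      simp [ThermalField.fourTemp, ThermalField.bVec, ThermalField.metric, ThermalField.vorticity,
        Matrix.mulVec, dotProduct, Fin.sum_univ_four, Matrix.diagonal_mul] <;> ring
  have hb0 : β 0 = (1 + a * z) / T₀ := by rw [hβ4]; rfl
  have hb1 : β 1 = -(ω * y) / T₀ := by rw [hβ4]; rfl
  have hb2 : β 2 = ω * x / T₀ := by rw [hβ4]; rfl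
  have hb3 : β 3 = a * t / T₀ := by rw [hβ4]; rfl
  have hββ : ThermalField.mdot β β =
      1 / T₀ ^ 2 * ((1 + a * z) ^ 2 - a ^ 2 * t ^ 2 - (x ^ 2 + y ^ 2) * ω ^ 2) := by
    rw [ThermalField.mdot, hb0, hb1, hb2, hb3]
    field_simp
    ring
  have hκ : 0 < ThermalField.mdot β β := by rw [hββ]; positivity
  have hβ0 : 0 < β 0 := by rw [hb0]; positivity
  have hnorm : (Real.sqrt (ThermalField.mdot β β))⁻¹ * (Real.sqrt (ThermalField.mdot β β))⁻¹ *
      ThermalField.mdot β β = 1 := by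
    rw [← mul_inv, Real.mul_self_sqrt hκ.le, inv_mul_cancel₀ hκ.ne']
  have hαα : ThermalField.mdot α α =
      -((a ^ 2 * ((1 + a * z) ^ 2 - a ^ 2 * t ^ 2) + (x ^ 2 + y ^ 2) * ω ^ 4) /
        (ThermalField.mdot β β * T₀ ^ 4)) := by
    rw [← neg_div, eq_div_iff (by positivity), hα, ThermalField.alphaVec_vorticity]
    generalize (Real.sqrt (ThermalField.mdot β β))⁻¹ = l at hnorm
    have h1 : ThermalField.mdot
        (l • ![a / T₀ * β 3, -(ω / T₀ * β 2), ω / T₀ * β 1, a / T₀ * β 0])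
        (l • ![a / T₀ * β 3, -(ω / T₀ * β 2), ω / T₀ * β 1, a / T₀ * β 0]) =
        l * l * (-((a ^ 2 * ((1 + a * z) ^ 2 - a ^ 2 * t ^ 2) + (x ^ 2 + y ^ 2) * ω ^ 4) /
          T₀ ^ 4)) := by
      simp [ThermalField.mdot, hb0, hb1, hb2, hb3]
      field_simp
      ring
    rw [h1]
    have h2 : T₀ ^ 4 ≠ 0 := by positivity
    field_simp
    linear_combination -(a ^ 2 * ((1 + a * z) ^ 2 - a ^ 2 * t ^ 2) +
      (x ^ 2 + y ^ 2) * ω ^ 4) * hnorm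
  have hαw : ThermalField.mdot α w = -(a * ω / T₀ ^ 2) := by
    rw [hα, hw, ThermalField.alphaVec_vorticity, ThermalField.wVec_vorticity]
    generalize (Real.sqrt (ThermalField.mdot β β))⁻¹ = l at hnorm
    have h1 : ThermalField.mdot
        (l • ![a / T₀ * β 3, -(ω / T₀ * β 2), ω / T₀ * β 1, a / T₀ * β 0])
        (l • ![ω / T₀ * β 3, a / T₀ * β 2, -(a / T₀ * β 1), ω / T₀ * β 0]) =
        -(a * ω / T₀ ^ 2) * (l * l * ThermalField.mdot β β) := by
      simp [ThermalField.mdot]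
      field_simp
      ring
    rw [h1, hnorm, mul_one]
  -- The auxiliary `r` is the squared distance from the axis, which stays meaningful when `ω = 0`.
  have hrω : (x ^ 2 + y ^ 2) * (ω / T₀) ^ 2 = β 1 ^ 2 + β 2 ^ 2 := by
    rw [hb1, hb2]
    field_simp
    ring
  have hval : ∀ v : ℂ, ThermalField.IsThermalPsiSq (ThermalField.bVec T₀)
      (ThermalField.vorticity T₀ a ω) X v ↔
        v = ((1 / (12 * ThermalField.mdot β β) : ℝ) : ℂ) -
          (((β 0 ^ 2 - β 3 ^ 2) * (a / T₀) ^ 2 + (x ^ 2 + y ^ 2) * (ω / T₀) ^ 4) /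
            (48 * Real.pi ^ 2 * ThermalField.mdot β β ^ 2) : ℝ) := by
    intro v
    obtain ⟨c, hc⟩ := ThermalField.exists_psiSqImag_expansion (X := X) (a := a)
      (by positivity) hrω hβ0 hκ
    have hray : ∀ ξ : ℝ, ThermalField.psiSqRay (ThermalField.bVec T₀)
        (ThermalField.vorticity T₀ a ω) X ξ =
        ThermalField.psiSqImag (ThermalField.shiftedB β (ThermalField.vorticity T₀ a ω) X ξ)
          (ThermalField.imagVorticity (ThermalField.vorticity T₀ a ω) ξ) X := fun ξ => by
      rw [hβX]
      rfl
    simp only [← hray] at hc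
    exact ThermalField.distillate_continuation_iff hc v
  have hπ := Real.pi_ne_zero
  have hD := hβ.ne'
  refine ⟨hβ4, hββ, hαα, hαw, fun ξ => ⟨ThermalField.ae_summable_iterate ξ hβ0 hκ,
    ThermalField.integrable_phaseSpaceDensity ξ hβ0 hκ⟩, fun v => ?_, fun v => ?_⟩
  · rw [hval, ← Complex.ofReal_sub]
    suffices h : 1 / (12 * ThermalField.mdot β β) -
        ((β 0 ^ 2 - β 3 ^ 2) * (a / T₀) ^ 2 + (x ^ 2 + y ^ 2) * (ω / T₀) ^ 4) /
          (48 * Real.pi ^ 2 * ThermalField.mdot β β ^ 2) = _ by rw [h]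
    rw [hββ, hb0, hb3]
    generalize (1 + a * z) ^ 2 - a ^ 2 * t ^ 2 - (x ^ 2 + y ^ 2) * ω ^ 2 = D at hD ⊢
    field_simp
  · rw [hval, ← Complex.ofReal_sub]
    suffices h : 1 / (12 * ThermalField.mdot β β) -
        ((β 0 ^ 2 - β 3 ^ 2) * (a / T₀) ^ 2 + (x ^ 2 + y ^ 2) * (ω / T₀) ^ 4) /
          (48 * Real.pi ^ 2 * ThermalField.mdot β β ^ 2) = _ by rw [h]
    rw [hαα, hb0, hb3]
    generalize ThermalField.mdot β β = κ at hκ ⊢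
    field_simp
    ring
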